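/- Let $$\varphi(-q)=\sum_{k=-\infty}^{\infty}(-1)^k q^{k^2},\qquad \psi(-q)=\sum_{k=0}^{\infty}(-q)^{k(k+1)/2},$$ and define integer sequences $(\overline{a}_5(n))_{n\ge 0}$ and $(\overline{b}_5(n))_{n\ge 0}$ by the formal power series identities $$\sum_{n=0}^{\infty}\overline{a}_5(n)q^n=\frac{\varphi^5(-q^5)}{\varphi(-q)},\qquad \sum_{n=0}^{\infty}\overline{b}_5(n)q^n=\frac{\psi^5(-q^5)}{\psi(-q)}.$$ Then for every integer $n\ge 0$, $$\overline{a}_5(20n+6)=20\,\overline{b}_5(10n)\qquad\text{and}\qquad \overline{a}_5(20n+14)=20\,\overline{b}_5(10n+4).$$ In particular, $\overline{a}_5(20n+6)\equiv 0\pmod 5$ for every $n\ge 0$ (the Gireesh--Ray--Shivashankar congruence). -/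

import Mathlib

/-- The theta series `φ(-q) = ∑_{k ∈ ℤ} (-1)^k q^(k^2)` as a formal power series in `q` over `ℤ`.
The coefficient of `q^m` collects the integers `k` with `k^2 = m`; all of them lie
in the interval `[-m, m]`. -/
noncomputable def phiNeg : PowerSeries ℤ :=
  PowerSeries.mk fun m : ℕ =>
    ∑ k ∈ Finset.Icc (-(m : ℤ)) (m : ℤ), if k ^ 2 = (m : ℤ) then (-1 : ℤ) ^ k.natAbs else 0

/-- The theta series `ψ(-q) = ∑_{k ≥ 0} (-q)^(k(k+1)/2)` as a formal power series in `q` over `ℤ`.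
The coefficient of `q^m` collects the natural numbers `k` with `k(k+1)/2 = m`; all of them
satisfy `k ≤ m`. -/
noncomputable def psiNeg : PowerSeries ℤ :=
  PowerSeries.mk fun m : ℕ =>
    ∑ k ∈ Finset.range (m + 1),
      if k * (k + 1) / 2 = m then (-1 : ℤ) ^ (k * (k + 1) / 2) else 0

/-- The series `F(q^5)^5 / F(q)`, for an integral power series `F` with constant coefficient `1`. -/
noncomputable def fiveCoreQuotient (F : PowerSeries ℤ) : PowerSeries ℤ :=
  (PowerSeries.expand 5 (by norm_num) F) ^ 5 * PowerSeries.invOfUnit F 1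

/-- `∑ aBar5 n q^n = φ(-q^5)^5 / φ(-q)`. -/
noncomputable def aBar5 (n : ℕ) : ℤ :=
  PowerSeries.coeff n (fiveCoreQuotient phiNeg)

/-- `∑ bBar5 n q^n = ψ(-q^5)^5 / ψ(-q)`. -/
noncomputable def bBar5 (n : ℕ) : ℤ :=
  PowerSeries.coeff n (fiveCoreQuotient psiNeg)

theorem constantCoeff_phiNeg : PowerSeries.constantCoeff phiNeg = 1 := by
  rw [← PowerSeries.coeff_zero_eq_constantCoeff_apply]
  simp [phiNeg]

theorem constantCoeff_psiNeg : PowerSeries.constantCoeff psiNeg = 1 := by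
  rw [← PowerSeries.coeff_zero_eq_constantCoeff_apply]
  simp [psiNeg]

/-- The quotient is a genuine one. -/
theorem fiveCoreQuotient_mul (F : PowerSeries ℤ) (hF : PowerSeries.constantCoeff F = 1) :
    fiveCoreQuotient F * F = (PowerSeries.expand 5 (by norm_num) F) ^ 5 := by
  rw [fiveCoreQuotient, mul_assoc, PowerSeries.invOfUnit_mul F 1 (by simpa using hF), mul_one]

open scoped PowerSeries.WithPiTopology
open PowerSeries Filter Topology

/-! Write f_m for `eulerFun m`, E = f_1^5/f_5 (`eisenstein`), D = q f_5^5/f_1 (`eisensteinDual`),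
and E', D' for their images under q ↦ q². The product formulas for φ and ψ give A = φ(-q^5)^5/φ(-q)
= D²/D' and B = q³ ψ(q^5)^5/ψ(q) = D'²/D. Classical theta identities of level 10 turn these
quotients into linear combinations (`level_ten_relations`): 5A = E + 4E' + 15D + 20D' and 20B = E -
E' + 5D - 15D'.

Let χ be the quadratic character mod 5. Two facts about coefficients finish the proof. First, E = 1
- 5 ∑ (∑_{d ∣ n} χ(d) d) q^n (`eisenstein_mul_eulerFun`), so E_{2m} = -E_m for odd m, since 1 +
2χ(2) = -1. Second, E_n = -5 χ(n) D_n when 5 ∤ n, obtained from the 5-dissection of f_1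
(`sect_eisenstein_add`, `sect_eisenstein_sub`). For m odd with χ(m) = -1, the series E' and D'
contribute nothing to the coefficient B_m, and everything reduces to E_m: 5A_{2m} = 10E_m and 20B_m
= 2E_m, hence A_{2m} = 20B_m. The theorem is the case m = 10n + 3 or 10n + 7, where the shift by q³
leaves an even index, so passing from ψ(q) to ψ(-q) costs no sign.

The analytic input is the Jacobi triple product, Jacobi's formula for f_1^3, and a splitting of
double theta sums into cosets of the Gaussian ideal (2 + i) (`hasSum_gaussian`). -/

/-- The Gaussian binomial coefficient in the parameter `Q`. -/
def gaussBinom {R : Type*} [CommRing R] (Q : R) : ℕ → ℕ → R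
  | _, 0 => 1
  | 0, _ + 1 => 0
  | n + 1, k + 1 => gaussBinom Q n k + Q ^ (k + 1) * gaussBinom Q n (k + 1)

/-- The `q`-Pochhammer symbol `(Q; Q)_n`. -/
def qFactorial {R : Type*} [CommRing R] (Q : R) (n : ℕ) : R :=
  ∏ k ∈ Finset.range n, (1 - Q ^ (k + 1))

/-! ### Gaussian binomial coefficients. -/

section GaussBinom

variable {R : Type*} [CommRing R] (Q : R)

@[simp] theorem gaussBinom_zero_right (n : ℕ) : gaussBinom Q n 0 = 1 := by
  cases n <;> rfl

@[simp] theorem gaussBinom_zero_succ (k : ℕ) : gaussBinom Q 0 (k + 1) = 0 := rfl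

theorem gaussBinom_succ_succ (n k : ℕ) :
    gaussBinom Q (n + 1) (k + 1) = gaussBinom Q n k + Q ^ (k + 1) * gaussBinom Q n (k + 1) := rfl

theorem gaussBinom_eq_zero_of_lt {n k : ℕ} (h : n < k) : gaussBinom Q n k = 0 := by
  induction n generalizing k with
  | zero => cases k with
    | zero => omega
    | succ k => rfl
  | succ n ih => cases k with
    | zero => omega
    | succ k => rw [gaussBinom_succ_succ, ih (by omega), ih (by omega)]; ring

theorem qFactorial_succ (n : ℕ) : qFactorial Q (n + 1) = qFactorial Q n * (1 - Q ^ (n + 1)) :=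
  Finset.prod_range_succ _ _

theorem gaussBinom_self (n : ℕ) : gaussBinom Q n n = 1 := by
  induction n with
  | zero => rfl
  | succ n ih =>
    rw [gaussBinom_succ_succ, ih, gaussBinom_eq_zero_of_lt Q (Nat.lt_succ_self n)]; ring

theorem gaussBinom_mul_qFactorial (l k : ℕ) :
    gaussBinom Q (l + k) k * (qFactorial Q k * qFactorial Q l) = qFactorial Q (l + k) := by
  suffices ∀ n l k, l + k = n →
      gaussBinom Q n k * (qFactorial Q k * qFactorial Q l) = qFactorial Q n from this _ l k rfl
  intro n
  induction n with
  | zero =>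
    intro l k h
    obtain ⟨rfl, rfl⟩ : l = 0 ∧ k = 0 := by omega
    simp [qFactorial]
  | succ n ih =>
    intro l k h
    rcases k with _ | k
    · obtain rfl : l = n + 1 := by omega
      simp [qFactorial]
    rcases l with _ | l
    · obtain rfl : k = n := by omega
      simp [gaussBinom_self, qFactorial]
    · have h1 := ih (l + 1) k (by omega)
      have h2 := ih l (k + 1) (by omega)
      have h3 : Q ^ (n + 1) = Q ^ (k + 1) * Q ^ (l + 1) := by rw [← pow_add]; congr 1; omega
      rw [gaussBinom_succ_succ, qFactorial_succ Q n, h3]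
      rw [qFactorial_succ Q l] at h1 ⊢
      rw [qFactorial_succ Q k] at h2 ⊢
      linear_combination (1 - Q ^ (k + 1)) * h1 + Q ^ (k + 1) * (1 - Q ^ (l + 1)) * h2

/-- The second Pascal rule. In the finite triple product a new factor in y is absorbed by the
defining rule, a new factor in x by this one. -/
theorem gaussBinom_succ_succ' (n k : ℕ) (h : k ≤ n) :
    gaussBinom Q (n + 1) (k + 1) =
      Q ^ (n - k) * gaussBinom Q n k + gaussBinom Q n (k + 1) := by
  induction n generalizing k with
  | zero =>
    obtain rfl : k = 0 := by omega
    simp [gaussBinom_succ_succ]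
  | succ n ih =>
    rw [gaussBinom_succ_succ Q (n + 1)]
    rcases k with _ | k
    · rw [ih 0 (by omega)]
      have := ih 0 (by omega)
      rw [gaussBinom_succ_succ Q n 0] at this
      simp only [gaussBinom_zero_right, Nat.sub_zero, zero_add, pow_one, mul_one] at this ⊢
      linear_combination this
    · rcases Nat.lt_or_ge k n with hk | hk
      · rw [ih (k + 1) (by omega)]
        have e1 : n + 1 - (k + 1) = n - k := by omega
        have e2 : n - k = n - (k + 1) + 1 := by omega
        have h1 := ih k (by omega)
        have h2 := ih (k + 1) (by omega)
        rw [gaussBinom_succ_succ] at h1 h2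
        rw [e1]
        rw [gaussBinom_succ_succ Q n k]
        rw [e2] at h1 ⊢
        simp only [pow_succ] at h1 h2 ⊢
        linear_combination h1 + h2
      · obtain rfl : k = n := by omega
        simp [gaussBinom_self, gaussBinom_eq_zero_of_lt]

theorem map_gaussBinom {S : Type*} [CommRing S] (f : R →+* S) (n k : ℕ) :
    f (gaussBinom Q n k) = gaussBinom (f Q) n k := by
  induction n generalizing k with
  | zero => cases k <;> simp
  | succ n ih => cases k with
    | zero => simp
    | succ k => simp [gaussBinom_succ_succ, ih]

end GaussBinom

/-! ### The finite Jacobi triple product. -/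

/-- The `j`-th term of the bilateral theta series with parameters `x`, `y`:
`x ^ j * (x * y) ^ (j * (j - 1) / 2)`, with `x⁻¹` read as `y / (x * y)`. -/
def thetaTerm {R : Type*} [CommRing R] (x y : R) : ℤ → R
  | Int.ofNat k => x ^ k * (x * y) ^ (k.choose 2)
  | Int.negSucc k => y ^ (k + 1) * (x * y) ^ ((k + 1).choose 2)

section FiniteTripleProduct

variable {R : Type*} [CommRing R] (x y : R)

theorem thetaTerm_natCast (k : ℕ) : thetaTerm x y k = x ^ k * (x * y) ^ (k.choose 2) := rfl

theorem thetaTerm_neg_natCast (k : ℕ) :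
    thetaTerm x y (-(k : ℤ)) = y ^ k * (x * y) ^ (k.choose 2) := by
  cases k with
  | zero => simp [thetaTerm]
  | succ k => rfl

theorem thetaTerm_neg (j : ℤ) : thetaTerm x y (-j) = thetaTerm y x j := by
  rcases Int.eq_nat_or_neg j with ⟨k, rfl | rfl⟩
  · rw [thetaTerm_neg_natCast, thetaTerm_natCast, mul_comm x y]
  · rw [neg_neg, thetaTerm_neg_natCast, thetaTerm_natCast, mul_comm x y]

/-- With Q = xy, consecutive terms have ratio x Q^j. Multiplying by Q^l with l = n - j keeps all
exponents nonnegative, so nothing has to be invertible. -/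
theorem mul_pow_mul_thetaTerm (n : ℕ) (j : ℤ) (l : ℕ) (h : j + l = n) :
    x * (x * y) ^ n * thetaTerm x y j = (x * y) ^ l * thetaTerm x y (j + 1) := by
  rcases le_or_gt 0 j with hj | hj
  · lift j to ℕ using hj
    obtain rfl : n = j + l := by omega
    rw [← Nat.cast_succ, thetaTerm_natCast, thetaTerm_natCast, Nat.succ_eq_add_one,
      Nat.choose_succ_succ' j 1, Nat.choose_one_right]
    ring
  · obtain ⟨k, rfl⟩ : ∃ k : ℕ, j = -((k + 1 : ℕ) : ℤ) := ⟨(-j - 1).toNat, by omega⟩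
    obtain rfl : l = n + (k + 1) := by omega
    have : -((k + 1 : ℕ) : ℤ) + 1 = -(k : ℤ) := by push_cast; ring
    rw [this, thetaTerm_neg_natCast, thetaTerm_neg_natCast, Nat.choose_succ_succ' k 1,
      Nat.choose_one_right]
    ring

theorem mul_pow_mul_thetaTerm' (n : ℕ) (j : ℤ) (l : ℕ) (h : l = n + j) :
    y * (x * y) ^ n * thetaTerm x y j = (x * y) ^ l * thetaTerm x y (j - 1) := by
  have := mul_pow_mul_thetaTerm y x n (-j) l (by omega)
  rw [mul_comm y x, thetaTerm_neg, show -j + 1 = -(j - 1) by ring, thetaTerm_neg] at this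
  exact this

/-- The finite form of the Jacobi triple product identity. -/
theorem finite_tripleProduct (n m : ℕ) :
    (∏ k ∈ Finset.range n, (1 + x * (x * y) ^ k)) * ∏ k ∈ Finset.range m, (1 + y * (x * y) ^ k) =
      ∑ i ∈ Finset.range (n + m + 1), gaussBinom (x * y) (n + m) i * thetaTerm x y (i - m) := by
  induction n with
  | zero =>
    induction m with
    | zero => simp [thetaTerm]
    | succ m ih =>
      rw [Finset.prod_range_succ, ← mul_assoc, ih, Finset.sum_range_succ' _ (0 + (m + 1)),
        mul_add, mul_one, ← add_assoc 0 m 1]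
      have h1 : ∑ i ∈ Finset.range (0 + m + 1), gaussBinom (x * y) (0 + m + 1) (i + 1) *
          thetaTerm x y ((i + 1 : ℕ) - (m + 1 : ℕ)) =
          ∑ i ∈ Finset.range (0 + m + 1), gaussBinom (x * y) (0 + m) i * thetaTerm x y (i - m) +
          ∑ i ∈ Finset.range (0 + m + 1), (x * y) ^ (i + 1) * gaussBinom (x * y) (0 + m) (i + 1) *
            thetaTerm x y ((i + 1 : ℕ) - m - 1) := by
        rw [← Finset.sum_add_distrib]
        refine Finset.sum_congr rfl fun i _ => ?_
        rw [gaussBinom_succ_succ]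
        have e1 : ((i + 1 : ℕ) - (m + 1 : ℕ) : ℤ) = i - m := by push_cast; ring
        have e2 : ((i + 1 : ℕ) - (m : ℤ) - 1 : ℤ) = i - m := by push_cast; ring
        rw [e1, e2]; ring
      have h2 : (∑ i ∈ Finset.range (0 + m + 1), gaussBinom (x * y) (0 + m) i *
          thetaTerm x y (i - m)) * (y * (x * y) ^ m) =
          ∑ i ∈ Finset.range (0 + m + 1), (x * y) ^ (i + 1) * gaussBinom (x * y) (0 + m) (i + 1) *
            thetaTerm x y ((i + 1 : ℕ) - m - 1) +
          gaussBinom (x * y) (0 + m + 1) 0 * thetaTerm x y ((0 : ℕ) - (m + 1 : ℕ)) := by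
        rw [Finset.sum_range_succ', Finset.sum_range_succ _ (0 + m),
          gaussBinom_eq_zero_of_lt _ (Nat.lt_succ_self _), add_mul, Finset.sum_mul]
        simp only [mul_zero, zero_mul, add_zero]
        congr 1
        · refine Finset.sum_congr rfl fun i _ => ?_
          have := mul_pow_mul_thetaTerm' x y m ((i + 1 : ℕ) - m) (i + 1) (by push_cast; ring)
          linear_combination gaussBinom (x * y) (0 + m) (i + 1) * this
        · have := mul_pow_mul_thetaTerm' x y m ((0 : ℕ) - m) 0 (by push_cast; ring)
          have e2 : ((0 : ℕ) - (m : ℤ) - 1 : ℤ) = (0 : ℕ) - (m + 1 : ℕ) := by push_cast; ring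
          rw [e2] at this
          simp only [gaussBinom_zero_right]
          linear_combination this
      rw [h2, ← add_assoc]
      exact congrArg (· + _) h1.symm
  | succ n ih =>
    rw [Finset.prod_range_succ, mul_right_comm, ih, show n + 1 + m = n + m + 1 by ring,
      Finset.sum_range_succ' _ (n + m + 1), mul_add, mul_one]
    have h1 : ∑ i ∈ Finset.range (n + m + 1), gaussBinom (x * y) (n + m + 1) (i + 1) *
        thetaTerm x y ((i + 1 : ℕ) - m) =
        ∑ i ∈ Finset.range (n + m + 1), gaussBinom (x * y) (n + m) (i + 1) *
          thetaTerm x y ((i + 1 : ℕ) - m) +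
        ∑ i ∈ Finset.range (n + m + 1), gaussBinom (x * y) (n + m) i * thetaTerm x y (i - m) *
          (x * (x * y) ^ n) := by
      rw [← Finset.sum_add_distrib]
      refine Finset.sum_congr rfl fun i hi => ?_
      have hi' : i ≤ n + m := Nat.lt_succ_iff.mp (Finset.mem_range.mp hi)
      rw [gaussBinom_succ_succ' _ _ _ hi']
      have := mul_pow_mul_thetaTerm x y n (i - m) (n + m - i) (by omega)
      have e1 : ((i + 1 : ℕ) - m : ℤ) = i - m + 1 := by push_cast; ring
      rw [e1]
      linear_combination -gaussBinom (x * y) (n + m) i * this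
    have h2 : ∑ i ∈ Finset.range (n + m + 1), gaussBinom (x * y) (n + m) i *
        thetaTerm x y (i - m) =
        ∑ i ∈ Finset.range (n + m + 1), gaussBinom (x * y) (n + m) (i + 1) *
          thetaTerm x y ((i + 1 : ℕ) - m) +
        gaussBinom (x * y) (n + m + 1) 0 * thetaTerm x y ((0 : ℕ) - m) := by
      rw [Finset.sum_range_succ', Finset.sum_range_succ _ (n + m),
        gaussBinom_eq_zero_of_lt _ (Nat.lt_succ_self _)]
      simp
    rw [h1, Finset.sum_mul]
    linear_combination h2

end FiniteTripleProduct

/-! ### Infinite products, the triple product in the limit, and Jacobi's cube. -/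

/-- The infinite product `∏_{k ≥ 0} (1 + ε X ^ (a + b k))`. -/
noncomputable def eulerProd (ε : ℤ) (a b : ℕ) : ℤ⟦X⟧ :=
  ∏' k : ℕ, (1 + C ε * X ^ (a + b * k))

theorem hasProd_eulerProd (ε : ℤ) (a : ℕ) {b : ℕ} (hb : 0 < b) :
    HasProd (fun k : ℕ => 1 + C ε * X ^ (a + b * k)) (eulerProd ε a b) := by
  refine (WithPiTopology.multipliable_one_add_of_tendsto_order_atTop_nhds_top ℤ ?_).hasProd
  refine ENat.tendsto_nhds_top_iff_natCast_lt.mpr fun n =>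
    eventually_atTop.mpr ⟨n + 1, fun k hk => ?_⟩
  refine lt_of_lt_of_le (Nat.cast_lt.mpr (Nat.lt_succ_self n)) (le_order _ _ fun i hi => ?_)
  rw [coeff_C_mul, coeff_X_pow, if_neg, mul_zero]
  have : (i : ℕ∞) < ((n + 1 : ℕ) : ℕ∞) := hi
  have := Nat.cast_lt.mp this
  nlinarith

theorem tendsto_eulerProd (ε : ℤ) (a : ℕ) {b : ℕ} (hb : 0 < b) :
    Tendsto (fun n => ∏ k ∈ Finset.range n, (1 + C ε * X ^ (a + b * k) : ℤ⟦X⟧)) atTop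
      (𝓝 (eulerProd ε a b)) :=
  (hasProd_eulerProd ε a hb).tendsto_prod_nat

theorem tendsto_qFactorial {b : ℕ} (hb : 0 < b) :
    Tendsto (fun n => qFactorial (X ^ b : ℤ⟦X⟧) n) atTop (𝓝 (eulerProd (-1) b b)) := by
  refine (tendsto_eulerProd (-1) b hb).congr fun n => Finset.prod_congr rfl fun k _ => ?_
  rw [← pow_mul, map_neg, map_one, mul_add_one]
  ring

theorem X_pow_dvd_qFactorial_sub {b : ℕ} (hb : 0 < b) {l k : ℕ} (h : l ≤ k) :
    (X ^ l : ℤ⟦X⟧) ∣ qFactorial (X ^ b) k - qFactorial (X ^ b) l := by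
  induction k, h using Nat.le_induction with
  | base => simp
  | succ k hk ih =>
    have : (X ^ l : ℤ⟦X⟧) ∣ (X ^ b) ^ (k + 1) := by
      rw [← pow_mul]
      exact pow_dvd_pow _ (by nlinarith)
    rw [qFactorial_succ, show ∀ p q r : ℤ⟦X⟧, p * (1 - q) - r = (p - r) - p * q by intros; ring]
    exact dvd_sub ih (this.mul_left _)

theorem isUnit_qFactorial {b : ℕ} (hb : 0 < b) (k : ℕ) :
    IsUnit (qFactorial (X ^ b : ℤ⟦X⟧) k) := by
  rw [isUnit_iff_constantCoeff, qFactorial, map_prod]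
  simp [hb.ne']

/-- All (Q; Q)_m with m ≥ l agree modulo X^l and are units, so (Q)_n (Q)_{2n} / ((Q)_i (Q)_{2n-i})
is 1 modulo X^l. -/
theorem X_pow_dvd_qFactorial_mul_gaussBinom_sub_one {b : ℕ} (hb : 0 < b) {n i l : ℕ}
    (h1 : l ≤ i) (h2 : l + i ≤ n + n) (h3 : l ≤ n) :
    (X ^ l : ℤ⟦X⟧) ∣ qFactorial (X ^ b) n * gaussBinom (X ^ b) (n + n) i - 1 := by
  have key := gaussBinom_mul_qFactorial (X ^ b : ℤ⟦X⟧) (n + n - i) i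
  rw [Nat.sub_add_cancel (by omega)] at key
  obtain ⟨u, hu⟩ := X_pow_dvd_qFactorial_sub hb h1
  obtain ⟨v, hv⟩ := X_pow_dvd_qFactorial_sub hb (show l ≤ n + n - i by omega)
  obtain ⟨w, hw⟩ := X_pow_dvd_qFactorial_sub hb h3
  obtain ⟨z, hz⟩ := X_pow_dvd_qFactorial_sub hb (show l ≤ n + n by omega)
  rw [sub_eq_iff_eq_add] at hu hv hw hz
  rw [hu, hv, hz] at key
  have hunit := ((isUnit_qFactorial hb l).mul (isUnit_qFactorial hb l))
  rw [← hunit.dvd_mul_right, hw]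
  generalize qFactorial (X ^ b : ℤ⟦X⟧) l = p at *
  generalize gaussBinom (X ^ b : ℤ⟦X⟧) (n + n) i = g at *
  refine ⟨(p + X ^ l * w) * (z - g * (u * p + v * p + X ^ l * u * v)) + p * w, ?_⟩
  linear_combination (p + X ^ l * w) * key

/-- Passage to the limit, coefficient by coefficient. Central terms, 2|j| ≤ n, have their Gaussian
weight replaced by 1; for outer terms the divisibility of τ j already kills the coefficient.
Allowing an arbitrary τ lets the same lemma serve the differentiated identity for the cube. -/
theorem hasSum_of_tendsto_gaussBinom {b : ℕ} (hb : 0 < b) {τ : ℤ → ℤ⟦X⟧}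
    (hτ : ∀ j, X ^ (j.natAbs - 1) ∣ τ j) {F : ℤ⟦X⟧}
    (hF : Tendsto (fun n : ℕ => qFactorial (X ^ b) n *
      ∑ i ∈ Finset.range (n + n + 1), gaussBinom (X ^ b) (n + n) i * τ (i - n)) atTop (𝓝 F)) :
    HasSum τ F := by
  rw [WithPiTopology.hasSum_iff_hasSum_coeff]
  intro d
  rw [WithPiTopology.tendsto_iff_coeff_tendsto] at hF
  have h := hF d
  rw [nhds_discrete, tendsto_pure] at h
  obtain ⟨n, hn, hd⟩ := (h.and (eventually_ge_atTop (2 * d + 4))).exists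
  have hzero : ∀ j : ℤ, n < 2 * j.natAbs → coeff d (τ j) = 0 := fun j hj =>
    X_pow_dvd_iff.mp (hτ j) d (by omega)
  have hs : coeff d F = ∑ j ∈ Finset.Icc (-(n : ℤ)) n, coeff d (τ j) := by
    rw [← hn, Finset.mul_sum, map_sum]
    refine Finset.sum_nbij' (fun i => (i : ℤ) - n) (fun j => (j + n).toNat) ?_ ?_ ?_ ?_ ?_
    · intro i hi
      simp only [Finset.mem_range, Finset.mem_Icc] at *
      omega
    · intro j hj
      simp only [Finset.mem_range, Finset.mem_Icc] at *
      omega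
    · intro i hi
      simp
    · intro j hj
      simp only [Finset.mem_Icc] at *
      omega
    · intro i hi
      rw [Finset.mem_range] at hi
      rcases le_or_gt (2 * ((i : ℤ) - n).natAbs) n with hj | hj
      · have h1 := X_pow_dvd_qFactorial_mul_gaussBinom_sub_one hb (n := n) (i := i) (l := d + 1)
          (by omega) (by omega) (by omega)
        have h2 := X_pow_dvd_iff.mp (h1.mul_right (τ (i - n))) d (Nat.lt_succ_self d)
        rw [sub_mul, one_mul, map_sub, sub_eq_zero] at h2
        rw [← mul_assoc, h2]
      · rw [hzero _ hj]
        refine X_pow_dvd_iff.mp (((hτ (i - n)).mul_left _).mul_left _) d (by omega)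
  rw [hs]
  refine hasSum_sum_of_ne_finset_zero fun j hj => hzero j ?_
  rw [Finset.mem_Icc] at hj
  omega

theorem thetaTerm_C_mul_X_pow (ε : ℤ) (hε : ε * ε = 1) (a c : ℕ) (j : ℤ) (e : ℕ)
    (he : 2 * (e : ℤ) = (a + c) * j ^ 2 + (a - c) * j) :
    thetaTerm (C ε * X ^ a : ℤ⟦X⟧) (C ε * X ^ c) j = C (ε ^ j.natAbs) * X ^ e := by
  have hQ : (C ε * X ^ a : ℤ⟦X⟧) * (C ε * X ^ c) = X ^ (a + c) := by
    rw [mul_mul_mul_comm, ← map_mul, hε, map_one, one_mul, pow_add]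
  have hch : ∀ k : ℕ, 2 * (k.choose 2 : ℤ) = k * (k - 1) := by
    intro k
    have := Nat.choose_two_right k
    have h2 : k * (k - 1) = 2 * k.choose 2 := by
      rw [this, Nat.mul_div_cancel' (Nat.even_mul_pred_self k).two_dvd]
    rcases k with _ | k
    · simp
    · rw [← Nat.cast_ofNat, ← Nat.cast_mul, ← h2]; push_cast; simp
  rcases Int.eq_nat_or_neg j with ⟨k, rfl | rfl⟩
  · rw [thetaTerm_natCast, hQ, mul_pow, ← map_pow, ← pow_mul, ← pow_mul, mul_assoc, ← pow_add,
      Int.natAbs_natCast]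
    congr 2
    have := hch k
    zify
    refine mul_left_cancel₀ (two_ne_zero' ℤ) ?_
    linear_combination (a + c) * this - he
  · rw [thetaTerm_neg_natCast, hQ, mul_pow, ← map_pow, ← pow_mul, ← pow_mul, mul_assoc, ← pow_add,
      Int.natAbs_neg, Int.natAbs_natCast]
    congr 2
    have := hch k
    zify
    refine mul_left_cancel₀ (two_ne_zero' ℤ) ?_
    linear_combination (a + c) * this - he

/-- The Jacobi triple product identity with parameters `ε X ^ a`, `ε X ^ c`, where `ε ^ 2 = 1`. -/
theorem hasSum_tripleProduct (ε : ℤ) (hε : ε * ε = 1) (a c : ℕ) (hc : 0 < c) (e : ℤ → ℕ)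
    (he : ∀ j, 2 * (e j : ℤ) = (a + c) * j ^ 2 + (a - c) * j) :
    HasSum (fun j : ℤ => C (ε ^ j.natAbs) * X ^ e j)
      (eulerProd (-1) (a + c) (a + c) * (eulerProd ε a (a + c) * eulerProd ε c (a + c))) := by
  have hQ : (C ε * X ^ a : ℤ⟦X⟧) * (C ε * X ^ c) = X ^ (a + c) := by
    rw [mul_mul_mul_comm, ← map_mul, hε, map_one, one_mul, pow_add]
  have hb : 0 < a + c := by omega
  simp_rw [← fun j => thetaTerm_C_mul_X_pow ε hε a c j (e j) (he j)]
  refine hasSum_of_tendsto_gaussBinom hb ?_ ?_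
  · intro j
    rw [thetaTerm_C_mul_X_pow ε hε a c j (e j) (he j)]
    refine (pow_dvd_pow _ ?_).mul_left _
    have h := he j
    have hmul : ∀ k : ℕ, 0 ≤ (k : ℤ) * (k - 1) ∧ 0 ≤ ((k : ℤ) - 1) * (k - 2) := fun k => by
      rcases k with _ | _ | k
      · simp
      · simp
      · push_cast; constructor <;> nlinarith
    have hc' : (1 : ℤ) ≤ c := by exact_mod_cast hc
    rcases Int.eq_nat_or_neg j with ⟨k, hk⟩
    obtain ⟨h1, h2⟩ := hmul k
    have h3 : 0 ≤ ((c : ℤ) - 1) * (k * (k - 1)) := mul_nonneg (by omega) h1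
    have h4 : 0 ≤ (a : ℤ) * (k * (k - 1)) := mul_nonneg (by omega) h1
    have h5 : 0 ≤ (a : ℤ) * k := by positivity
    have h6 : 0 ≤ ((c : ℤ) - 1) * k := mul_nonneg (by omega) (by omega)
    have hk' : (k : ℤ) - 1 ≤ e j := by
      rcases hk with hk | hk <;> rw [hk] at h ⊢ <;> nlinarith
    omega
  · refine ((tendsto_qFactorial hb).mul
      ((tendsto_eulerProd ε a hb).mul (tendsto_eulerProd ε c hb))).congr fun n => ?_
    rw [← hQ, ← finite_tripleProduct, hQ]
    simp only [← pow_mul, mul_assoc, ← pow_add]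

/-- Jacobi's identity for the cube of the Euler product. -/
theorem hasSum_eulerProd_cube (e : ℤ → ℕ) (he : ∀ j, 2 * (e j : ℤ) = j ^ 2 + j) :
    HasSum (fun j : ℤ => C ((-1) ^ j.natAbs * j) * X ^ e j) (eulerProd (-1) 1 1 ^ 3) := by
  have hch : ∀ k : ℕ, 2 * (k.choose 2 : ℤ) = k * (k - 1) := by
    intro k
    have h2 : k * (k - 1) = 2 * k.choose 2 := by
      rw [Nat.choose_two_right k, Nat.mul_div_cancel' (Nat.even_mul_pred_self k).two_dvd]
    rcases k with _ | k
    · simp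
    · rw [← Nat.cast_ofNat, ← Nat.cast_mul, ← h2]; push_cast; simp
  let ι : ℤ⟦X⟧ →+* DualNumber ℤ⟦X⟧ := TrivSqZeroExt.inlHom ℤ⟦X⟧ ℤ⟦X⟧
  obtain ⟨δ, hδ, hδδ⟩ : ∃ δ : DualNumber ℤ⟦X⟧, (∀ u v, (ι u + ι v * δ).snd = v) ∧ δ * δ = 0 :=
    ⟨DualNumber.eps, fun u v => by simp [ι], DualNumber.eps_mul_eps⟩
  -- These are -z and -q/z at z = 1 + δ with δ² = 0. The triple product vanishes at z = 1 through
  -- its factor 1 + x = -δ, so its δ-part is the derivative there; next to that δ every other factor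
  -- may be evaluated at δ = 0.
  obtain ⟨x, hx⟩ : ∃ x, x = -(1 + δ) := ⟨_, rfl⟩
  obtain ⟨y, hy⟩ : ∃ y, y = -(1 - δ) * ι X := ⟨_, rfl⟩
  have hxy : x * y = ι X := by
    rw [hx, hy]
    linear_combination -(ι X) * hδδ
  have hxk : ∀ k : ℕ, x ^ k = (-1) ^ k * (1 + (k : DualNumber ℤ⟦X⟧) * δ) := by
    intro k
    induction k with
    | zero => simp
    | succ k ih =>
      rw [pow_succ, ih, hx]
      push_cast
      linear_combination -(-1) ^ k * k * hδδ
  have hyk : ∀ k : ℕ, y ^ k = (-1) ^ k * (1 - (k : DualNumber ℤ⟦X⟧) * δ) * ι X ^ k := by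
    intro k
    induction k with
    | zero => simp
    | succ k ih =>
      rw [pow_succ, ih, hy]
      push_cast
      linear_combination -(-1) ^ k * k * ι X ^ (k + 1) * hδδ
  have hterm : ∀ j : ℤ, (thetaTerm x y (-j)).snd = -(C ((-1) ^ j.natAbs * j) * X ^ e j) := by
    intro j
    have hj := he j
    rcases Int.eq_nat_or_neg j with ⟨k, rfl | rfl⟩
    · have hek : e k = k + k.choose 2 := by
        have := hch k
        zify
        refine mul_left_cancel₀ (two_ne_zero' ℤ) ?_
        linear_combination hj - this
      have : thetaTerm x y (-k) = ι ((-1 : ℤ⟦X⟧) ^ k * X ^ e k) + ι (-((-1) ^ k * (k : ℤ⟦X⟧) * X ^ e k)) * δ := by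
        rw [thetaTerm_neg_natCast, hxy, hyk, hek]
        simp only [map_mul, map_pow, map_neg, map_one, map_natCast]
        ring
      rw [this, hδ]
      simp
    · have hek : e (-k) = k.choose 2 := by
        have := hch k
        zify
        refine mul_left_cancel₀ (two_ne_zero' ℤ) ?_
        linear_combination hj - this
      have : thetaTerm x y k =
          ι ((-1 : ℤ⟦X⟧) ^ k * X ^ e (-k)) + ι ((-1) ^ k * (k : ℤ⟦X⟧) * X ^ e (-k)) * δ := by
        rw [thetaTerm_natCast, hxy, hxk, hek]
        simp only [map_mul, map_pow, map_neg, map_one, map_natCast]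
        ring
      rw [neg_neg, this, hδ]
      simp
  have hsum : HasSum (fun j => (thetaTerm x y j).snd) (-(eulerProd (-1) 1 1 ^ 3)) := by
    refine hasSum_of_tendsto_gaussBinom one_pos ?_ ?_
    · intro j
      rw [← neg_neg j, hterm]
      refine ((pow_dvd_pow _ ?_).mul_left _).neg_right
      have h := he (-j)
      rcases Int.eq_nat_or_neg j with ⟨k, hk⟩
      have h1 : 0 ≤ ((k : ℤ) - 1) * (k - 2) := by
        rcases k with _ | _ | k
        · simp
        · simp
        · push_cast; nlinarith
      have hk' : (k : ℤ) - 1 ≤ e (-j) := by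
        rcases hk with hk | hk <;> rw [hk] at h ⊢ <;> nlinarith
      omega
    -- The shift makes the product in x nonempty, so the factor -δ can be split off, leaving n
    -- factors in x against n + 1 in y.
    · rw [← tendsto_add_atTop_iff_nat 1]
      have ht := tendsto_qFactorial one_pos
      have ht1 := (tendsto_add_atTop_iff_nat 1).mpr ht
      rw [show ∀ f : ℤ⟦X⟧, -(f ^ 3) = f * -(f * f) by intros; ring]
      refine (ht1.mul (ht.mul ht1).neg).congr fun n => ?_
      congr 1
      have hfin := finite_tripleProduct x y (n + 1) (n + 1)
      have hl : (∏ k ∈ Finset.range (n + 1), (1 + x * (x * y) ^ k)) *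
          ∏ k ∈ Finset.range (n + 1), (1 + y * (x * y) ^ k) =
          ι 0 + ι (-(qFactorial (X ^ 1) n * qFactorial (X ^ 1) (n + 1))) * δ := by
        have h1 : ∀ k, δ * (1 + x * (x * y) ^ (k + 1)) = δ * ι (1 - (X ^ 1) ^ (k + 1)) := by
          intro k
          rw [hxy, hx]
          simp only [map_sub, map_one, map_pow, pow_one]
          linear_combination -(ι X) ^ (k + 1) * hδδ
        have h2 : ∀ k, δ * (1 + y * (x * y) ^ k) = δ * ι (1 - (X ^ 1) ^ (k + 1)) := by
          intro k
          rw [hxy, hy]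
          simp only [map_sub, map_one, map_pow, pow_one]
          linear_combination (ι X) ^ (k + 1) * hδδ
        have h3 : ∀ (f : ℕ → DualNumber ℤ⟦X⟧) (g : ℕ → ℤ⟦X⟧) (m : ℕ),
            (∀ k, δ * f k = δ * ι (g k)) →
            δ * ∏ k ∈ Finset.range m, f k = δ * ι (∏ k ∈ Finset.range m, g k) := by
          intro f g m hfg
          induction m with
          | zero => simp
          | succ m ih =>
            rw [Finset.prod_range_succ, Finset.prod_range_succ, map_mul]
            linear_combination f m * ih + ι (∏ k ∈ Finset.range m, g k) * hfg m
        have h4 := h3 _ _ n h1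
        have h5 := h3 _ _ (n + 1) h2
        rw [Finset.prod_range_succ']
        simp only [qFactorial, map_neg, map_mul, map_zero]
        simp only [pow_zero, mul_one]
        rw [hx] at h4 h5 ⊢
        linear_combination (-∏ k ∈ Finset.range (n + 1), (1 + y * (-(1 + δ) * y) ^ k)) * h4 -
          ι (∏ k ∈ Finset.range n, (1 - (X ^ 1) ^ (k + 1))) * h5
      rw [hl] at hfin
      have hsnd := congrArg TrivSqZeroExt.snd hfin
      rw [hδ, TrivSqZeroExt.snd_sum] at hsnd
      rw [hsnd]
      refine Finset.sum_congr rfl fun i _ => ?_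
      rw [hxy, ← map_gaussBinom, pow_one]
      simp [ι]
  have h := ((Equiv.neg ℤ).hasSum_iff.mpr hsum).neg
  rw [neg_neg] at h
  refine h.congr_fun fun j => ?_
  rw [Function.comp_apply, Equiv.neg_apply, hterm, neg_neg]

/-! ### Substitutions and factorisations of Euler products. -/

theorem continuous_expand {p : ℕ} (hp : p ≠ 0) : Continuous (expand (R := ℤ) p hp) := by
  rw [continuous_iff_continuousAt]
  intro f
  rw [ContinuousAt, WithPiTopology.tendsto_iff_coeff_tendsto]
  intro d
  simp only [coeff_expand]
  split_ifs
  · exact (WithPiTopology.continuous_coeff ℤ _).continuousAt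
  · exact tendsto_const_nhds

theorem expand_eulerProd {p : ℕ} (hp : p ≠ 0) (ε : ℤ) (a : ℕ) {b : ℕ} (hb : 0 < b) :
    expand p hp (eulerProd ε a b) = eulerProd ε (p * a) (p * b) := by
  have h := (hasProd_eulerProd ε a hb).map (expand (R := ℤ) p hp) (continuous_expand hp)
  refine h.unique ((hasProd_eulerProd ε (p * a)
    (Nat.mul_pos (Nat.pos_of_ne_zero hp) hb)).congr_fun fun k => ?_)
  simp only [Function.comp_apply, map_add, map_one, map_mul, map_pow, expand_X, expand_C]
  rw [← pow_mul]
  congr 3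
  ring

theorem eulerProd_eq_prod (ε : ℤ) (a : ℕ) {b : ℕ} (hb : 0 < b) {p : ℕ} (hp : 0 < p) :
    eulerProd ε a b = ∏ r : Fin p, eulerProd ε (a + b * r) (b * p) := by
  have : NeZero p := ⟨hp.ne'⟩
  have h := ((Equiv.prodComm _ _).trans (Nat.divModEquiv p).symm).hasProd_iff.mpr
    (hasProd_eulerProd ε a hb)
  refine (h.prod_fiberwise fun r => ?_).unique (hasProd_fintype _)
  refine (hasProd_eulerProd ε (a + b * r) (Nat.mul_pos hb hp)).congr_fun fun k => ?_
  simp only [Function.comp_apply, Equiv.trans_apply, Equiv.prodComm_apply, Prod.swap_prod_mk,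
    Nat.divModEquiv_symm_apply]
  congr 3
  ring

theorem eulerProd_neg_one_mul_eulerProd_one (a : ℕ) {b : ℕ} (hb : 0 < b) :
    eulerProd (-1) a b * eulerProd 1 a b = eulerProd (-1) (2 * a) (2 * b) := by
  refine ((hasProd_eulerProd (-1) a hb).mul (hasProd_eulerProd 1 a hb)).unique
    ((hasProd_eulerProd (-1) (2 * a) (by omega : 0 < 2 * b)).congr_fun fun k => ?_)
  rw [show 2 * a + 2 * b * k = 2 * (a + b * k) by ring, pow_mul']
  simp only [map_neg, map_one]
  ring

theorem eulerProd_zero_left (ε : ℤ) {b : ℕ} (hb : 0 < b) :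
    eulerProd ε 0 b = (1 + C ε) * eulerProd ε b b := by
  refine tendsto_nhds_unique ((tendsto_add_atTop_iff_nat 1).mpr (tendsto_eulerProd ε 0 hb))
    (((tendsto_eulerProd ε b hb).const_mul _).congr fun n => ?_)
  rw [Finset.prod_range_succ', mul_comm]
  simp [mul_add, add_comm]

theorem constantCoeff_eulerProd (ε : ℤ) {a b : ℕ} (ha : 0 < a) (hb : 0 < b) :
    constantCoeff (eulerProd ε a b) = 1 := by
  have h := ((WithPiTopology.continuous_constantCoeff ℤ).tendsto _).comp
    (tendsto_eulerProd ε a hb)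
  refine tendsto_nhds_unique h (tendsto_const_nhds.congr fun n => ?_)
  simp [map_prod, ha.ne']

theorem eulerProd_ne_zero (ε : ℤ) {a b : ℕ} (ha : 0 < a) (hb : 0 < b) : eulerProd ε a b ≠ 0 := by
  intro h
  have := constantCoeff_eulerProd ε ha hb
  simp [h] at this

/-- `∏_{k ≥ 1} (1 - X ^ (m k))`. -/
noncomputable def eulerFun (m : ℕ) : ℤ⟦X⟧ := eulerProd (-1) m m

theorem eulerFun_ne_zero {m : ℕ} (hm : 0 < m) : eulerFun m ≠ 0 := eulerProd_ne_zero _ hm hm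

theorem constantCoeff_eulerFun {m : ℕ} (hm : 0 < m) : constantCoeff (eulerFun m) = 1 :=
  constantCoeff_eulerProd _ hm hm

theorem expand_eulerFun {p : ℕ} (hp : p ≠ 0) {m : ℕ} (hm : 0 < m) :
    expand p hp (eulerFun m) = eulerFun (p * m) := expand_eulerProd hp _ _ hm

theorem eulerFun_one_eq_prod_five :
    eulerFun 1 = eulerProd (-1) 1 5 * eulerProd (-1) 2 5 * eulerProd (-1) 3 5 *
      eulerProd (-1) 4 5 * eulerFun 5 := by
  rw [eulerFun, eulerProd_eq_prod (-1) 1 one_pos (p := 5) (by norm_num), Fin.prod_univ_five]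
  rfl

/-- Each factor 1 + q^n is (1 - q^{2n})/(1 - q^n), here over the n prime to 5. -/
theorem prod_eulerProd_one_mul :
    eulerProd 1 1 5 * eulerProd 1 2 5 * eulerProd 1 3 5 * eulerProd 1 4 5 *
      (eulerFun 1 * eulerFun 10) = eulerFun 2 * eulerFun 5 := by
  have h2 : eulerFun 2 = eulerProd (-1) 2 10 * eulerProd (-1) 4 10 * eulerProd (-1) 6 10 *
      eulerProd (-1) 8 10 * eulerFun 10 := by
    rw [eulerFun, eulerProd_eq_prod (-1) 2 two_pos (p := 5) (by norm_num), Fin.prod_univ_five]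
    rfl
  have e1 := eulerProd_neg_one_mul_eulerProd_one 1 (b := 5) (by norm_num)
  have e2 := eulerProd_neg_one_mul_eulerProd_one 2 (b := 5) (by norm_num)
  have e3 := eulerProd_neg_one_mul_eulerProd_one 3 (b := 5) (by norm_num)
  have e4 := eulerProd_neg_one_mul_eulerProd_one 4 (b := 5) (by norm_num)
  norm_num only at e1 e2 e3 e4
  rw [h2, eulerFun_one_eq_prod_five, ← e1, ← e2, ← e3, ← e4]
  ring

theorem prod_eulerProd_ten_mul :
    eulerProd (-1) 1 10 * eulerProd (-1) 3 10 * eulerProd (-1) 7 10 * eulerProd (-1) 9 10 *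
      (eulerFun 2 * eulerFun 5) = eulerFun 1 * eulerFun 10 := by
  have h1 : eulerFun 1 = eulerProd (-1) 1 2 * eulerFun 2 := by
    rw [eulerFun, eulerProd_eq_prod (-1) 1 one_pos (p := 2) (by norm_num), Fin.prod_univ_two]
    rfl
  have h2 : eulerProd (-1) 1 2 = eulerProd (-1) 1 10 * eulerProd (-1) 3 10 *
      eulerProd (-1) 5 10 * eulerProd (-1) 7 10 * eulerProd (-1) 9 10 := by
    rw [eulerProd_eq_prod (-1) 1 two_pos (p := 5) (by norm_num), Fin.prod_univ_five]
    rfl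
  have h5 : eulerFun 5 = eulerProd (-1) 5 10 * eulerFun 10 := by
    rw [eulerFun, eulerProd_eq_prod (-1) 5 (by norm_num) (p := 2) (by norm_num),
      Fin.prod_univ_two]
    rfl
  rw [h1, h2, h5]
  ring

/-! ### Product formulas for φ and ψ. -/

/-- A series whose coefficients collect a family of monomials is the sum of that family. -/
theorem hasSum_C_mul_X_pow {ι : Type*} (w : ι → ℤ) (e : ι → ℕ) (s : ℕ → Finset ι)
    (hs : ∀ i, i ∈ s (e i)) :
    HasSum (fun i => C (w i) * X ^ e i)
      (mk fun d => ∑ i ∈ s d, if e i = d then w i else 0 : ℤ⟦X⟧) := by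
  rw [WithPiTopology.hasSum_iff_hasSum_coeff]
  intro d
  have hc : ∀ i, coeff d (C (w i) * X ^ e i : ℤ⟦X⟧) = if e i = d then w i else 0 := fun i => by
    rw [coeff_C_mul, coeff_X_pow]
    simp [eq_comm]
  simp only [hc, coeff_mk]
  refine hasSum_sum_of_ne_finset_zero fun i hi => if_neg ?_
  rintro rfl
  exact hi (hs i)

theorem hasSum_phiNeg :
    HasSum (fun k : ℤ => C ((-1) ^ k.natAbs) * X ^ (k ^ 2).toNat) phiNeg := by
  have h := hasSum_C_mul_X_pow (fun k : ℤ => (-1) ^ k.natAbs) (fun k => (k ^ 2).toNat)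
    (fun d => Finset.Icc (-(d : ℤ)) d) fun k => by
      rw [Finset.mem_Icc]
      have : 0 ≤ k ^ 2 := sq_nonneg k
      constructor
      · rcases le_or_gt 0 k <;> [omega; (rw [Int.toNat_of_nonneg this]; nlinarith)]
      · rw [Int.toNat_of_nonneg this]
        rcases le_or_gt k 0 <;> nlinarith
  convert h using 1
  unfold phiNeg
  congr 1
  funext d
  refine Finset.sum_congr rfl fun k _ => ?_
  have : (k ^ 2).toNat = d ↔ k ^ 2 = d := by
    have : 0 ≤ k ^ 2 := sq_nonneg k
    omega
  simp only [this]

/-- `ψ(q) = ∑_{k ≥ 0} q ^ (k (k + 1) / 2)`. -/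
noncomputable def psiPos : ℤ⟦X⟧ := rescale (-1) psiNeg

theorem hasSum_psiPos : HasSum (fun k : ℕ => (X : ℤ⟦X⟧) ^ (k * (k + 1) / 2)) psiPos := by
  have h := hasSum_C_mul_X_pow (fun _ : ℕ => 1) (fun k => k * (k + 1) / 2)
    (fun d => Finset.range (d + 1)) fun k => by
      rw [Finset.mem_range, Nat.lt_succ_iff, Nat.le_div_iff_mul_le two_pos]
      rcases k with _ | k
      · simp
      · nlinarith
  simp only [map_one, one_mul] at h
  convert h using 1
  unfold psiPos psiNeg
  ext d
  rw [coeff_rescale, coeff_mk, coeff_mk, Finset.mul_sum]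
  refine Finset.sum_congr rfl fun k _ => ?_
  split_ifs with hk
  · rw [hk, ← mul_pow]; simp
  · simp

theorem phiNeg_mul_eulerFun : phiNeg * eulerFun 2 = eulerFun 1 ^ 2 := by
  have h := hasSum_tripleProduct (-1) (by norm_num) 1 1 one_pos (fun k => (k ^ 2).toNat)
    fun k => by
      rw [Int.toNat_of_nonneg (sq_nonneg k)]; push_cast; ring
  have h1 : eulerFun 1 = eulerProd (-1) 1 2 * eulerFun 2 := by
    rw [eulerFun, eulerProd_eq_prod (-1) 1 one_pos (p := 2) (by norm_num), Fin.prod_univ_two]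
    rfl
  rw [hasSum_phiNeg.unique h, h1, eulerFun]
  ring

/-- The indices j and -1 - j give the same triangular number. -/
theorem hasSum_two_mul_psiPos (e : ℤ → ℕ) (he : ∀ j, 2 * (e j : ℤ) = j ^ 2 + j) :
    HasSum (fun j : ℤ => (X : ℤ⟦X⟧) ^ e j) (2 * psiPos) := by
  have hk : ∀ k : ℕ, 2 * ((k * (k + 1) / 2 : ℕ) : ℤ) = k * (k + 1) := fun k => by
    have := Nat.mul_div_cancel' (Nat.even_mul_succ_self k).two_dvd
    exact_mod_cast this
  rw [two_mul]
  refine HasSum.of_nat_of_neg_add_one ?_ ?_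
  · refine hasSum_psiPos.congr_fun fun k => ?_
    congr 1
    rw [← Nat.cast_inj (R := ℤ)]
    have := he k
    have := hk k
    refine mul_left_cancel₀ (two_ne_zero' ℤ) ?_
    linarith
  · refine hasSum_psiPos.congr_fun fun k => ?_
    congr 1
    rw [← Nat.cast_inj (R := ℤ)]
    have := he (-(k + 1))
    have := hk k
    refine mul_left_cancel₀ (two_ne_zero' ℤ) ?_
    linarith

/-- The triple product with a = 0, c = 1 sums to 2ψ(q); the 2 on the product side is the factor 1 +
q^0 and is cancelled. -/
theorem psiPos_mul_eulerFun : psiPos * eulerFun 1 = eulerFun 2 ^ 2 := by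
  obtain ⟨e, he⟩ : ∃ e : ℤ → ℕ, ∀ j, 2 * (e j : ℤ) = j ^ 2 + j :=
    ⟨fun j => ((j ^ 2 + j) / 2).toNat, fun j => by
      have h1 : 0 ≤ j ^ 2 + j := by rcases le_or_gt 0 j <;> nlinarith
      rw [Int.toNat_of_nonneg (Int.ediv_nonneg h1 two_pos.le),
        Int.mul_ediv_cancel' (by
          have := Int.even_mul_succ_self j
          rw [show j ^ 2 + j = j * (j + 1) by ring]
          exact this.two_dvd)]⟩
  have h := hasSum_tripleProduct 1 (by norm_num) 0 1 one_pos (fun j => e (-j)) fun j => by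
    rw [he]; push_cast; ring
  simp only [one_pow, map_one, one_mul] at h
  have h2 := ((Equiv.neg ℤ).hasSum_iff.mpr (hasSum_two_mul_psiPos e he)).unique h
  have h3 := eulerProd_neg_one_mul_eulerProd_one 1 one_pos
  norm_num only at h2 h3
  rw [eulerProd_zero_left 1 one_pos, map_one] at h2
  have h4 : (2 : ℤ⟦X⟧) ≠ 0 := fun h => by
    have := congrArg (coeff 0) h
    rw [← map_ofNat C 2, coeff_zero_C, map_zero] at this
    exact two_ne_zero this
  refine mul_left_cancel₀ h4 ?_
  unfold eulerFun
  rw [← h3]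
  linear_combination eulerProd (-1) 1 1 * h2

/-! ### Double sums over the Gaussian integers modulo 2 + i. -/

theorem summable_iff_finite_coeff {ι : Type*} {f : ι → ℤ⟦X⟧} :
    Summable f ↔ ∀ d, {i | coeff d (f i) ≠ 0}.Finite := by
  rw [WithPiTopology.summable_iff_summable_coeff]
  refine forall_congr' fun d => ⟨fun h => ?_, fun h => summable_of_hasFiniteSupport h⟩
  have := h.tendsto_cofinite_zero
  rw [nhds_discrete, tendsto_pure] at this
  exact this

theorem hasSum_mul_prod {ι κ : Type*} {f : ι → ℤ⟦X⟧} {g : κ → ℤ⟦X⟧} {s t : ℤ⟦X⟧}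
    (hf : HasSum f s) (hg : HasSum g t) :
    HasSum (fun p : ι × κ => f p.1 * g p.2) (s * t) := by
  refine hf.mul hg (summable_iff_finite_coeff.mpr fun d => ?_)
  have h1 := summable_iff_finite_coeff.mp hf.summable
  have h2 := summable_iff_finite_coeff.mp hg.summable
  refine ((Finset.finite_toSet (Finset.HasAntidiagonal.antidiagonal d)).biUnion
    (fun a _ => (h1 a.1).prod (h2 a.2))).subset ?_
  rintro ⟨i, j⟩ hij
  rw [Set.mem_ofPred_eq, coeff_mul] at hij
  obtain ⟨a, ha, hne⟩ := Finset.exists_ne_zero_of_sum_ne_zero hij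
  exact Set.mem_biUnion ha ⟨left_ne_zero_of_mul hne, right_ne_zero_of_mul hne⟩

theorem PowerSeries.eq_zero_of_eq_neg {f : ℤ⟦X⟧} (h : f = -f) : f = 0 := by
  ext d
  have := congrArg (coeff d) h
  rw [map_neg] at this
  rw [map_zero]
  omega

/-- Decomposition of a sum over `ℤ × ℤ`, invariant under a rotation by a right angle, into the
points divisible by the Gaussian integer `2 + i` and the rest. -/
theorem hasSum_gaussian (c : ℤ) (hc : c = 0 ∨ c = 1) {f : ℤ × ℤ → ℤ⟦X⟧} {S S₀ S₁ : ℤ⟦X⟧}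
    (hrot : ∀ x y, f (-c - y, x) = f (x, y)) (hf : HasSum f S)
    (h0 : HasSum (fun p : ℤ × ℤ => f (2 * p.1 - p.2, p.1 + 2 * p.2 + c)) S₀)
    (h1 : HasSum (fun p : ℤ × ℤ => f (2 * p.1 - p.2 - 1, p.1 + 2 * p.2 - c)) S₁) :
    S = S₀ + 4 * S₁ := by
  -- The five cosets of the ideal (2 + i). Row 0 is the zero coset; rows 2, 3, 4 are the successive
  -- images of row 1 under the right-angle rotation, whose centre is (-c/2, -c/2).
  let G : Fin 5 × ℤ × ℤ → ℤ × ℤ := fun p => ![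
    (2 * p.2.1 - p.2.2, p.2.1 + 2 * p.2.2 + c),
    (2 * p.2.1 - p.2.2 - 1, p.2.1 + 2 * p.2.2 - c),
    (-(p.2.1 + 2 * p.2.2), 2 * p.2.1 - p.2.2 - 1),
    (-c - (2 * p.2.1 - p.2.2 - 1), -(p.2.1 + 2 * p.2.2)),
    (p.2.1 + 2 * p.2.2 - c, -c - (2 * p.2.1 - p.2.2 - 1))] p.1
  have g0 : ∀ u v, G (0, u, v) = (2 * u - v, u + 2 * v + c) := fun _ _ => rfl
  have g1 : ∀ u v, G (1, u, v) = (2 * u - v - 1, u + 2 * v - c) := fun _ _ => rfl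
  have g2 : ∀ u v, G (2, u, v) = (-(u + 2 * v), 2 * u - v - 1) := fun _ _ => rfl
  have g3 : ∀ u v, G (3, u, v) = (-c - (2 * u - v - 1), -(u + 2 * v)) := fun _ _ => rfl
  have g4 : ∀ u v, G (4, u, v) = (u + 2 * v - c, -c - (2 * u - v - 1)) := fun _ _ => rfl
  have hfin : ∀ r : Fin 5, r = 0 ∨ r = 1 ∨ r = 2 ∨ r = 3 ∨ r = 4 := by decide
  have hG : Function.Bijective G := by
    constructor
    · rintro ⟨r, u, v⟩ ⟨r', u', v'⟩ h
      rcases hfin r with rfl | rfl | rfl | rfl | rfl <;>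
        rcases hfin r' with rfl | rfl | rfl | rfl | rfl <;>
        simp only [g0, g1, g2, g3, g4, Prod.mk.injEq, true_and] at h ⊢ <;> omega
    · rintro ⟨x, y⟩
      rcases (show (2 * x + y - c) % 5 = 0 ∨ (2 * x + y + 2 + c) % 5 = 0 ∨
        (2 * x + y + 1) % 5 = 0 ∨ (2 * x + y - 2 + 2 * c) % 5 = 0 ∨
        (2 * x + y - 1 + 3 * c) % 5 = 0 by omega) with h | h | h | h | h
      · exact ⟨(0, (2 * x + y - c) / 5, (2 * y - x - 2 * c) / 5), by
          rw [g0, Prod.mk.injEq]; omega⟩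
      · exact ⟨(1, (2 * x + y + 2 + c) / 5, (2 * y - x + 2 * c - 1) / 5), by
          rw [g1, Prod.mk.injEq]; omega⟩
      · exact ⟨(2, (2 * y - x + 2) / 5, (-(2 * x + y + 1)) / 5), by
          rw [g2, Prod.mk.injEq]; omega⟩
      · exact ⟨(3, (2 - 2 * x - y - 2 * c) / 5, (x - 2 * y + c - 1) / 5), by
          rw [g3, Prod.mk.injEq]; omega⟩
      · exact ⟨(4, (x - 2 * y + 2 - c) / 5, (2 * x + y + 3 * c - 1) / 5), by
          rw [g4, Prod.mk.injEq]; omega⟩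
  have h := ((Equiv.ofBijective G hG).hasSum_iff.mpr hf).prod_fiberwise (g := ![S₀, S₁, S₁, S₁, S₁])
    fun r => ?_
  · rw [h.unique (hasSum_fintype _), Fin.sum_univ_five]
    simp only [Matrix.cons_val]
    ring
  · have hrot2 : ∀ x y, f (-c - x, -c - y) = f (x, y) := fun x y =>
      (hrot (-c - y) x).trans (hrot x y)
    have hrot3 : ∀ x y, f (y, -c - x) = f (x, y) := fun x y => by
      rw [← hrot y, sub_sub_cancel]
    rcases hfin r with rfl | rfl | rfl | rfl | rfl
    · exact h0
    · exact h1
    · refine h1.congr_fun fun p => ?_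
      rw [← hrot]
      change f (G (2, p.1, p.2)) = _
      rw [g2]; congr 2; ring
    · refine h1.congr_fun fun p => ?_
      rw [← hrot2]
      change f (G (3, p.1, p.2)) = _
      rw [g3]; congr 2; ring
    · refine h1.congr_fun fun p => ?_
      rw [← hrot3]
      change f (G (4, p.1, p.2)) = _
      rw [g4]

/-! ### Theta identities from the coset splitting. -/

/-- `(-1) ^ j` for an integer `j`. -/
def intSign (j : ℤ) : ℤ := (-1) ^ j.natAbs

theorem intSign_eq_ite (j : ℤ) : intSign j = if j % 2 = 0 then 1 else -1 := by
  unfold intSign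
  split_ifs with h
  · exact Even.neg_one_pow (Nat.even_iff.mpr (by omega))
  · exact Odd.neg_one_pow (Nat.odd_iff.mpr (by omega))

theorem intSign_mul_of_even {a b c d : ℤ} (h : (a + b + c + d) % 2 = 0) :
    intSign a * intSign b = intSign c * intSign d := by
  simp only [intSign_eq_ite]
  split_ifs <;> omega

theorem intSign_mul_of_odd {a b c d : ℤ} (h : (a + b + c + d) % 2 = 1) :
    intSign a * intSign b = -(intSign c * intSign d) := by
  simp only [intSign_eq_ite]
  split_ifs <;> omega

/-- The exponent `((a + c) j ^ 2 + (a - c) j) / 2` of the `j`-th term of a theta series. -/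
def quadExp (a c : ℕ) (j : ℤ) : ℕ := (((a + c) * j ^ 2 + (a - c) * j) / 2).toNat

theorem two_mul_quadExp (a c : ℕ) (j : ℤ) :
    2 * (quadExp a c j : ℤ) = (a + c) * j ^ 2 + (a - c) * j := by
  have h1 : 0 ≤ j * (j + 1) := by rcases le_or_gt 0 j <;> nlinarith
  have h2 : 0 ≤ j * (j - 1) := by rcases le_or_gt j 0 <;> nlinarith
  have h3 : 0 ≤ (a + c) * j ^ 2 + (a - c) * j := by
    have h4 := mul_nonneg (Int.natCast_nonneg a) h1
    have h5 := mul_nonneg (Int.natCast_nonneg c) h2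
    linarith
  have h4 : (2 : ℤ) ∣ (a + c) * j ^ 2 + (a - c) * j := by
    rw [show (a + c) * j ^ 2 + (a - c) * j = a * (j * (j + 1)) + c * ((j - 1) * (j - 1 + 1)) by
      ring]
    exact dvd_add ((Int.even_mul_succ_self j).two_dvd.mul_left _)
      ((Int.even_mul_succ_self (j - 1)).two_dvd.mul_left _)
  rw [quadExp, Int.toNat_of_nonneg (Int.ediv_nonneg h3 two_pos.le), Int.mul_ediv_cancel' h4]

/-- The theta series `f(ε q ^ a, ε q ^ c)` of Ramanujan, as a product. -/
noncomputable def thetaSeries (ε : ℤ) (a c : ℕ) : ℤ⟦X⟧ :=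
  eulerProd (-1) (a + c) (a + c) * (eulerProd ε a (a + c) * eulerProd ε c (a + c))

theorem hasSum_thetaSeries_one (a c : ℕ) (hc : 0 < c) :
    HasSum (fun j : ℤ => (X : ℤ⟦X⟧) ^ quadExp a c j) (thetaSeries 1 a c) := by
  have h := hasSum_tripleProduct 1 (by norm_num) a c hc (quadExp a c) (two_mul_quadExp a c)
  simpa [thetaSeries] using h

theorem hasSum_thetaSeries_neg_one (a c : ℕ) (hc : 0 < c) :
    HasSum (fun j : ℤ => (C (intSign j) * X ^ quadExp a c j : ℤ⟦X⟧)) (thetaSeries (-1) a c) :=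
  hasSum_tripleProduct (-1) (by norm_num) a c hc (quadExp a c) (two_mul_quadExp a c)

theorem expand_hasSum {ι : Type*} {p : ℕ} (hp : p ≠ 0) {w : ι → ℤ} {e : ι → ℕ} {S : ℤ⟦X⟧}
    (h : HasSum (fun i => C (w i) * X ^ e i) S) :
    HasSum (fun i => C (w i) * X ^ (p * e i)) (expand p hp S) := by
  refine (h.map (expand (R := ℤ) p hp) (continuous_expand hp)).congr_fun fun i => ?_
  rw [Function.comp_apply, map_mul, map_pow, expand_C, expand_X, ← pow_mul]

/-- The square of 2ψ is a rotation-invariant double sum. On the zero coset the norm is multiplied by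
5, giving qψ(q^5)²; on another coset the quadratic form is diagonal in the new coordinates, so the
sum factors into two theta series. -/
theorem psiPos_sq :
    psiPos ^ 2 = X * expand 5 (by norm_num) psiPos ^ 2 +
      thetaSeries 1 1 4 * thetaSeries 1 2 3 := by
  have hT := two_mul_quadExp 1 0
  have hs := two_mul_quadExp 1 4
  have ht := two_mul_quadExp 2 3
  push_cast at hT hs ht
  have hψ := hasSum_two_mul_psiPos (quadExp 1 0) fun j => by rw [hT]; ring
  have hψ5 : HasSum (fun j : ℤ => (X : ℤ⟦X⟧) ^ (5 * quadExp 1 0 j))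
      (expand 5 (by norm_num) (2 * psiPos)) := by
    have := expand_hasSum (p := 5) (by norm_num) (w := fun _ : ℤ => 1) (e := quadExp 1 0)
      (S := 2 * psiPos) (by simpa using hψ)
    simpa using this
  have key := hasSum_gaussian 1 (Or.inr rfl) (S₀ := X * (expand 5 (by norm_num) (2 * psiPos) *
    expand 5 (by norm_num) (2 * psiPos))) (S₁ := thetaSeries 1 1 4 * thetaSeries 1 2 3)
    ?_ (hasSum_mul_prod hψ hψ) ?_ ?_
  · have h4 : (4 : ℤ⟦X⟧) ≠ 0 := fun h => by
      have := congrArg (coeff 0) h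
      rw [← map_ofNat C 4, coeff_zero_C, map_zero] at this
      exact four_ne_zero this
    refine mul_left_cancel₀ h4 ?_
    rw [map_mul, map_ofNat] at key
    linear_combination key
  · intro x y
    rw [mul_comm]
    congr 2
    rw [← Nat.cast_inj (R := ℤ)]
    refine mul_left_cancel₀ (two_ne_zero' ℤ) ?_
    rw [hT, hT]
    ring
  · refine ((hasSum_mul_prod hψ5 hψ5).mul_left X).congr_fun fun p => ?_
    rw [← pow_add, ← pow_add, ← pow_succ']
    congr 1
    rw [← Nat.cast_inj (R := ℤ)]
    push_cast
    refine mul_left_cancel₀ (two_ne_zero' ℤ) ?_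
    linear_combination hT (2 * p.1 - p.2) + hT (p.1 + 2 * p.2 + 1) - 5 * hT p.1 - 5 * hT p.2
  · refine (hasSum_mul_prod (hasSum_thetaSeries_one 1 4 (by norm_num))
      (hasSum_thetaSeries_one 2 3 (by norm_num))).congr_fun fun p => ?_
    rw [← pow_add, ← pow_add]
    congr 1
    rw [← Nat.cast_inj (R := ℤ)]
    push_cast
    refine mul_left_cancel₀ (two_ne_zero' ℤ) ?_
    linear_combination hT (2 * p.1 - p.2 - 1) + hT (p.1 + 2 * p.2 - 1) - hs p.1 - ht p.2

/-- The same splitting about the origin. The minus sign comes from the parity change on the nonzero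
coset, the factor q from the constant term 1 of its exponent. -/
theorem phiNeg_sq :
    phiNeg ^ 2 = expand 5 (by norm_num) phiNeg ^ 2 -
      4 * X * (thetaSeries (-1) 1 9 * thetaSeries (-1) 7 3) := by
  have hT := two_mul_quadExp 1 1
  have hs := two_mul_quadExp 1 9
  have ht := two_mul_quadExp 7 3
  push_cast at hT hs ht
  have hφ : HasSum (fun j : ℤ => (C (intSign j) * X ^ quadExp 1 1 j : ℤ⟦X⟧)) phiNeg := by
    refine hasSum_phiNeg.congr_fun fun j => ?_
    congr 2
    have := hT j
    omega
  have hφ5 := expand_hasSum (p := 5) (by norm_num) hφ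
  have key := hasSum_gaussian 0 (Or.inl rfl) (S₀ := expand 5 (by norm_num) phiNeg *
    expand 5 (by norm_num) phiNeg) (S₁ := -(X * (thetaSeries (-1) 1 9 * thetaSeries (-1) 7 3)))
    ?_ (hasSum_mul_prod hφ hφ) ?_ ?_
  · linear_combination key
  · intro x y
    simp only
    rw [mul_mul_mul_comm, mul_mul_mul_comm (C (intSign x)), ← map_mul, ← map_mul, ← pow_add,
      ← pow_add, intSign_mul_of_even (c := x) (d := y) (by omega)]
    congr 2
    rw [← Nat.cast_inj (R := ℤ)]
    push_cast
    refine mul_left_cancel₀ (two_ne_zero' ℤ) ?_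
    linear_combination hT (-0 - y) - hT y
  · refine (hasSum_mul_prod hφ5 hφ5).congr_fun fun p => ?_
    simp only
    rw [mul_mul_mul_comm, mul_mul_mul_comm (C (intSign p.1)), ← map_mul, ← map_mul, ← pow_add,
      ← pow_add, intSign_mul_of_even (c := p.1) (d := p.2) (by omega)]
    congr 2
    rw [← Nat.cast_inj (R := ℤ)]
    push_cast
    refine mul_left_cancel₀ (two_ne_zero' ℤ) ?_
    linear_combination hT (2 * p.1 - p.2) + hT (p.1 + 2 * p.2 + 0) - 5 * hT p.1 - 5 * hT p.2
  · refine ((hasSum_mul_prod (hasSum_thetaSeries_neg_one 1 9 (by norm_num))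
      (hasSum_thetaSeries_neg_one 7 3 (by norm_num))).mul_left X).neg.congr_fun fun p => ?_
    simp only
    rw [mul_mul_mul_comm, mul_mul_mul_comm (C (intSign p.1)), ← map_mul, ← map_mul, ← pow_add,
      ← pow_add, intSign_mul_of_odd (c := p.1) (d := p.2) (by omega), map_neg, mul_left_comm,
      ← pow_succ', neg_mul]
    congr 3
    rw [← Nat.cast_inj (R := ℤ)]
    push_cast
    refine mul_left_cancel₀ (two_ne_zero' ℤ) ?_
    linear_combination hT (2 * p.1 - p.2 - 1) + hT (p.1 + 2 * p.2 - 0) - hs p.1 - ht p.2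

/-! ### The operator q d/dq and the Lambert series of f_1^5/f_5. -/

/-- The operator `q d/dq`. -/
noncomputable def eulerOp : ℤ⟦X⟧ →+ ℤ⟦X⟧ where
  toFun f := X * derivative ℤ f
  map_zero' := by rw [map_zero, mul_zero]
  map_add' f g := by rw [map_add, mul_add]

theorem eulerOp_apply (f : ℤ⟦X⟧) : eulerOp f = X * derivative ℤ f := rfl

theorem eulerOp_mul (f g : ℤ⟦X⟧) : eulerOp (f * g) = f * eulerOp g + g * eulerOp f := by
  simp only [eulerOp_apply, Derivation.leibniz, smul_eq_mul]
  ring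

theorem coeff_eulerOp (f : ℤ⟦X⟧) (n : ℕ) : coeff n (eulerOp f) = n * coeff n f := by
  rw [eulerOp_apply]
  cases n with
  | zero => simp
  | succ n =>
    rw [coeff_succ_X_mul, coeff_derivative]
    push_cast
    ring

theorem continuous_eulerOp : Continuous eulerOp := by
  rw [continuous_iff_continuousAt]
  intro f
  rw [ContinuousAt, WithPiTopology.tendsto_iff_coeff_tendsto]
  intro d
  simp only [coeff_eulerOp]
  exact ((WithPiTopology.continuous_coeff ℤ d).tendsto f).const_mul _

theorem eulerOp_C_mul_X_pow (w : ℤ) (e : ℕ) :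
    eulerOp (C w * X ^ e) = C (w * e) * X ^ e := by
  ext n
  rw [coeff_eulerOp, coeff_C_mul, coeff_C_mul, coeff_X_pow]
  split_ifs with h
  · rw [h]; ring
  · ring

theorem eulerOp_hasSum {ι : Type*} {w : ι → ℤ} {e : ι → ℕ} {S : ℤ⟦X⟧}
    (h : HasSum (fun i => C (w i) * X ^ e i) S) :
    HasSum (fun i => C (w i * e i) * X ^ e i) (eulerOp S) :=
  (h.map eulerOp continuous_eulerOp).congr_fun fun i => by
    rw [Function.comp_apply, eulerOp_C_mul_X_pow]

/-- The involution j ↦ -1 - j keeps the exponent and reverses the sign. -/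
theorem hasSum_intSign_quadExp :
    HasSum (fun j : ℤ => (C (intSign j) * X ^ quadExp 1 0 j : ℤ⟦X⟧)) 0 := by
  have hT := two_mul_quadExp 1 0
  push_cast at hT
  have h := hasSum_C_mul_X_pow intSign (quadExp 1 0) (fun d => Finset.Icc (-(d + 1 : ℤ)) d)
    fun j => by
      rw [Finset.mem_Icc]
      have := hT j
      have h1 : 0 ≤ j * (j - 1) := by rcases le_or_gt j 0 <;> nlinarith
      have h2 : 0 ≤ (j + 2) * (j + 1) := by rcases le_or_gt j (-2) <;> nlinarith
      constructor <;> nlinarith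
  generalize (mk _ : ℤ⟦X⟧) = β at h
  have h' := ((Equiv.subLeft (-1 : ℤ)).hasSum_iff.mpr h)
  have : β = -β := h'.unique (h.neg.congr_fun fun j => by
    rw [Function.comp_apply, Equiv.subLeft_apply, ← neg_mul, ← map_neg]
    congr 2
    · simp only [intSign_eq_ite]
      split_ifs <;> omega
    · rw [← Nat.cast_inj (R := ℤ)]
      refine mul_left_cancel₀ (two_ne_zero' ℤ) ?_
      linear_combination hT (-1 - j) - hT j)
  rwa [eq_zero_of_eq_neg this] at h

/-- Put U = 2x + 1, V = 2y + 1. Squaring Jacobi's cube gives a double sum with weight UV; adding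
3(U² - V²)/8 changes nothing, because `hasSum_intSign_quadExp` sums to 0. The new weight is Re(((2 -
i)(U + iV))²)/8, so on multiples of 2 + i it becomes a multiple of a difference of squares and its
sum vanishes. On the other cosets it is 1 plus 5 times a difference of theta exponents, which q d/dq
produces. -/
theorem eulerFun_one_pow_six :
    eulerFun 1 ^ 6 = thetaSeries (-1) 1 4 * thetaSeries (-1) 2 3 +
      5 * (eulerOp (thetaSeries (-1) 1 4) * thetaSeries (-1) 2 3 -
        thetaSeries (-1) 1 4 * eulerOp (thetaSeries (-1) 2 3)) := by
  have hT := two_mul_quadExp 1 0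
  have hs := two_mul_quadExp 1 4
  have ht := two_mul_quadExp 2 3
  push_cast at hT hs ht
  have hB := hasSum_intSign_quadExp
  have hB' := eulerOp_hasSum hB
  have hB5 := expand_hasSum (p := 5) (by norm_num) hB
  have hB5' := expand_hasSum (p := 5) (by norm_num) hB'
  have hA : HasSum (fun j : ℤ => (C (intSign j * (2 * j + 1)) * X ^ quadExp 1 0 j : ℤ⟦X⟧))
      (2 * eulerFun 1 ^ 3) := by
    have h := ((hasSum_eulerProd_cube (quadExp 1 0) fun j => by rw [hT]; ring).mul_left 2).add hB
    rw [add_zero] at h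
    refine h.congr_fun fun j => ?_
    simp only [intSign, map_mul, map_add, map_one, map_ofNat]
    ring
  have hS := hasSum_thetaSeries_neg_one 1 4 (by norm_num)
  have hR := hasSum_thetaSeries_neg_one 2 3 (by norm_num)
  have hS' := eulerOp_hasSum hS
  have hR' := eulerOp_hasSum hR
  have hsum : HasSum (fun p : ℤ × ℤ => (C (intSign p.1 * intSign p.2 *
      ((2 * p.1 + 1) * (2 * p.2 + 1) + 3 * (quadExp 1 0 p.1 - quadExp 1 0 p.2))) *
      X ^ (quadExp 1 0 p.1 + quadExp 1 0 p.2) : ℤ⟦X⟧)) (4 * eulerFun 1 ^ 6) := by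
    have h := (hasSum_mul_prod hA hA).add
      (((hasSum_mul_prod hB' hB).sub (hasSum_mul_prod hB hB')).mul_left 3)
    rw [mul_zero, zero_mul, sub_zero, mul_zero, add_zero,
      show ∀ f : ℤ⟦X⟧, 2 * f ^ 3 * (2 * f ^ 3) = 4 * f ^ 6 by intro f; ring] at h
    refine h.congr_fun fun p => ?_
    simp only [map_mul, map_add, map_sub, map_one, map_ofNat, map_natCast]
    ring
  have h4 : (4 : ℤ⟦X⟧) ≠ 0 := fun h => by
    have := congrArg (coeff 0) h
    rw [← map_ofNat C 4, coeff_zero_C, map_zero] at this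
    exact four_ne_zero this
  have key := hasSum_gaussian 1 (Or.inr rfl) (S₀ := 0) (S₁ := thetaSeries (-1) 1 4 *
    thetaSeries (-1) 2 3 + 5 * (eulerOp (thetaSeries (-1) 1 4) * thetaSeries (-1) 2 3 -
        thetaSeries (-1) 1 4 * eulerOp (thetaSeries (-1) 2 3))) ?_ hsum ?_ ?_
  · rw [zero_add] at key
    exact mul_left_cancel₀ h4 key
  · intro x y
    simp only
    rw [intSign_mul_of_odd (c := x) (d := y) (by omega), add_comm (quadExp 1 0 _)]
    have : quadExp 1 0 (-1 - y) = quadExp 1 0 y := by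
      rw [← Nat.cast_inj (R := ℤ)]
      refine mul_left_cancel₀ (two_ne_zero' ℤ) ?_
      linear_combination hT (-1 - y) - hT y
    rw [this]
    congr 2
    ring
  · have h := ((((hasSum_mul_prod hB5' hB5).sub (hasSum_mul_prod hB5 hB5')).mul_left
      (-25)).mul_left X)
    simp only [map_zero, sub_self, mul_zero] at h
    refine h.congr_fun fun p => ?_
    simp only
    have e1 : quadExp 1 0 (2 * p.1 - p.2) + quadExp 1 0 (p.1 + 2 * p.2 + 1) =
        1 + 5 * quadExp 1 0 p.1 + 5 * quadExp 1 0 p.2 := by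
      rw [← Nat.cast_inj (R := ℤ)]
      push_cast
      refine mul_left_cancel₀ (two_ne_zero' ℤ) ?_
      linear_combination hT (2 * p.1 - p.2) + hT (p.1 + 2 * p.2 + 1) - 5 * hT p.1 - 5 * hT p.2
    have e2 : (2 * (2 * p.1 - p.2) + 1) * (2 * (p.1 + 2 * p.2 + 1) + 1) +
        3 * ((quadExp 1 0 (2 * p.1 - p.2) : ℤ) - quadExp 1 0 (p.1 + 2 * p.2 + 1)) =
        25 * ((quadExp 1 0 p.1 : ℤ) - quadExp 1 0 p.2) := by
      refine mul_left_cancel₀ (two_ne_zero' ℤ) ?_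
      linear_combination 3 * hT (2 * p.1 - p.2) - 3 * hT (p.1 + 2 * p.2 + 1) - 25 * hT p.1 +
        25 * hT p.2
    rw [e1, e2, intSign_mul_of_odd (c := p.1) (d := p.2) (by omega)]
    simp only [map_neg, map_mul, map_sub, map_ofNat, map_natCast]
    ring
  · have h := (hasSum_mul_prod hS hR).add
      (((hasSum_mul_prod hS' hR).sub (hasSum_mul_prod hS hR')).mul_left 5)
    refine h.congr_fun fun p => ?_
    simp only
    have e1 : quadExp 1 0 (2 * p.1 - p.2 - 1) + quadExp 1 0 (p.1 + 2 * p.2 - 1) =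
        quadExp 1 4 p.1 + quadExp 2 3 p.2 := by
      rw [← Nat.cast_inj (R := ℤ)]
      push_cast
      refine mul_left_cancel₀ (two_ne_zero' ℤ) ?_
      linear_combination hT (2 * p.1 - p.2 - 1) + hT (p.1 + 2 * p.2 - 1) - hs p.1 - ht p.2
    have e2 : (2 * (2 * p.1 - p.2 - 1) + 1) * (2 * (p.1 + 2 * p.2 - 1) + 1) +
        3 * ((quadExp 1 0 (2 * p.1 - p.2 - 1) : ℤ) - quadExp 1 0 (p.1 + 2 * p.2 - 1)) =
        1 + 5 * ((quadExp 1 4 p.1 : ℤ) - quadExp 2 3 p.2) := by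
      refine mul_left_cancel₀ (two_ne_zero' ℤ) ?_
      linear_combination 3 * hT (2 * p.1 - p.2 - 1) - 3 * hT (p.1 + 2 * p.2 - 1) - 5 * hs p.1 +
        5 * ht p.2
    rw [e1, e2, intSign_mul_of_even (c := p.1) (d := p.2) (by omega)]
    simp only [map_one, map_add, map_mul, map_sub, map_ofNat, map_natCast]
    ring

/-- The series `∑_n (∑_{d ∣ n, d ≡ a mod b} d) q ^ n`. -/
noncomputable def divisorSeries (a b : ℕ) : ℤ⟦X⟧ :=
  mk fun n => ∑ d ∈ n.divisors, if d % b = a then (d : ℤ) else 0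

theorem eulerOp_one_sub_X_pow {m : ℕ} (hm : 0 < m) :
    eulerOp (1 - X ^ m) = -((1 - X ^ m) *
      (mk fun n => if m ∣ n ∧ n ≠ 0 then (m : ℤ) else 0)) := by
  ext n
  rw [coeff_eulerOp, sub_mul, one_mul, map_neg, map_sub, map_sub, coeff_X_pow_mul',
    coeff_X_pow, coeff_one, coeff_mk, coeff_mk]
  have h1 : m ∣ m := dvd_rfl
  rcases lt_trichotomy n m with h | rfl | h
  · have hd : ¬(m ∣ n ∧ n ≠ 0) := fun h' => by
      have := Nat.le_of_dvd (Nat.pos_of_ne_zero h'.2) h'.1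
      omega
    rw [if_neg hd, if_neg (not_le.mpr h), if_neg h.ne]
    rcases n with _ | n <;> simp
  · simp [hm.ne']
  · have h2 : m ∣ n - m ↔ m ∣ n :=
      ⟨fun h' => by simpa [h.le] using Nat.dvd_add h' h1, fun h' => Nat.dvd_sub h' h1⟩
    have h3 : n ≠ 0 := by omega
    have h4 : n - m ≠ 0 := by omega
    rw [if_neg h3, if_neg h.ne', if_pos h.le]
    simp only [h2, h3, h4, ne_eq, not_false_eq_true, and_true, sub_self, mul_zero, neg_zero]

theorem hasSum_divisorSeries {a b : ℕ} (ha : 0 < a) (hab : a < b) :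
    HasSum (fun k : ℕ => (mk fun n => if a + b * k ∣ n ∧ n ≠ 0 then ((a + b * k : ℕ) : ℤ) else 0 :
      ℤ⟦X⟧)) (divisorSeries a b) := by
  rw [WithPiTopology.hasSum_iff_hasSum_coeff]
  intro n
  simp only [divisorSeries, coeff_mk]
  rcases eq_or_ne n 0 with rfl | hn
  · simp [hasSum_zero]
  have hs : ∑ d ∈ n.divisors, (if d % b = a then (d : ℤ) else 0) =
      ∑ k ∈ Finset.range (n + 1), if a + b * k ∣ n ∧ n ≠ 0 then ((a + b * k : ℕ) : ℤ) else 0 := by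
    rw [← Finset.sum_filter, ← Finset.sum_filter]
    have hdiv : ∀ d, d % b = a → a + b * (d / b) = d := fun d hd => by
      conv_rhs => rw [← Nat.mod_add_div d b, hd]
    refine Finset.sum_nbij' (fun d => d / b) (fun k => a + b * k) ?_ ?_ ?_ ?_ ?_
    · intro d hd
      rw [Finset.mem_filter, Nat.mem_divisors] at hd
      rw [Finset.mem_filter, Finset.mem_range, hdiv d hd.2]
      refine ⟨?_, hd.1⟩
      have h1 := Nat.le_of_dvd (Nat.pos_of_ne_zero hn) hd.1.1
      have h2 := Nat.div_le_self d b
      omega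
    · intro k hk
      rw [Finset.mem_filter] at hk
      rw [Finset.mem_filter, Nat.mem_divisors, Nat.add_mul_mod_self_left, Nat.mod_eq_of_lt hab]
      exact ⟨hk.2, rfl⟩
    · intro d hd
      exact hdiv d (Finset.mem_filter.mp hd).2
    · intro k _
      rw [Nat.add_mul_div_left _ _ (by omega), Nat.div_eq_of_lt hab, zero_add]
    · intro d hd
      rw [hdiv d (Finset.mem_filter.mp hd).2]
  rw [hs]
  refine hasSum_sum_of_ne_finset_zero fun k hk => if_neg ?_
  rintro ⟨h1, -⟩
  rw [Finset.mem_range] at hk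
  have := Nat.le_of_dvd (Nat.pos_of_ne_zero hn) h1
  nlinarith

theorem eulerOp_eulerProd {a b : ℕ} (ha : 0 < a) (hab : a < b) :
    eulerOp (eulerProd (-1) a b) = -(eulerProd (-1) a b * divisorSeries a b) := by
  have hb : 0 < b := by omega
  have h1 := tendsto_eulerProd (-1) a hb
  have h2 := (continuous_eulerOp.tendsto _).comp h1
  have h3 := (h1.mul (hasSum_divisorSeries ha hab).tendsto_sum_nat).neg
  refine tendsto_nhds_unique h2 (h3.congr fun n => ?_)
  rw [Function.comp_apply]
  induction n with
  | zero => simp [eulerOp_apply]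
  | succ n ih =>
    rw [Finset.prod_range_succ, Finset.sum_range_succ, eulerOp_mul, ← ih]
    have h4 := eulerOp_one_sub_X_pow (m := a + b * n) (by omega)
    rw [map_neg, map_one, neg_one_mul, ← sub_eq_add_neg, h4]
    ring

/-- The quadratic character modulo `5`. -/
def chiFive (n : ℕ) : ℤ :=
  if n % 5 = 1 ∨ n % 5 = 4 then 1 else if n % 5 = 2 ∨ n % 5 = 3 then -1 else 0

/-- The Eisenstein series `1 - 5 ∑_n (∑_{d ∣ n} (d / 5) d) q ^ n`. -/
noncomputable def eisenstein : ℤ⟦X⟧ :=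
  1 - 5 * mk fun n => ∑ d ∈ n.divisors, chiFive d * d

/-- The two theta series in `eulerFun_one_pow_six` multiply to f_1 f_5, so that identity says
f_1^5/f_5 is 1 plus 5 times the difference of their logarithmic derivatives, which are divisor sums.
-/
theorem eisenstein_mul_eulerFun : eisenstein * eulerFun 5 = eulerFun 1 ^ 5 := by
  have h1 := eulerOp_eulerProd (a := 1) (b := 5) (by norm_num) (by norm_num)
  have h2 := eulerOp_eulerProd (a := 2) (b := 5) (by norm_num) (by norm_num)
  have h3 := eulerOp_eulerProd (a := 3) (b := 5) (by norm_num) (by norm_num)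
  have h4 := eulerOp_eulerProd (a := 4) (b := 5) (by norm_num) (by norm_num)
  have hL : (mk fun n => ∑ d ∈ n.divisors, chiFive d * d : ℤ⟦X⟧) =
      divisorSeries 1 5 - divisorSeries 2 5 - divisorSeries 3 5 + divisorSeries 4 5 := by
    ext n
    simp only [divisorSeries, map_sub, map_add, coeff_mk]
    rw [← Finset.sum_sub_distrib, ← Finset.sum_sub_distrib, ← Finset.sum_add_distrib]
    refine Finset.sum_congr rfl fun d _ => ?_
    unfold chiFive
    split_ifs <;> omega
  have h6 := eulerFun_one_pow_six
  simp only [thetaSeries, eulerOp_mul] at h6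
  norm_num only at h6
  simp only [h1, h2, h3, h4] at h6
  have hne := eulerFun_ne_zero one_pos
  refine mul_left_cancel₀ hne ?_
  rw [← pow_succ', h6, eisenstein, hL, eulerFun_one_eq_prod_five]
  unfold eulerFun
  ring

/-! ### The 5-dissection of f_1 and the sections of E ± 5D. -/

/-- The substitution `q ↦ q ^ 5`. -/
noncomputable abbrev expandFive : ℤ⟦X⟧ →ₐ[ℤ] ℤ⟦X⟧ := expand 5 (by norm_num)

/-- The `r`-th component of the `5`-dissection of a power series. -/
noncomputable def sect (r : ℕ) (F : ℤ⟦X⟧) : ℤ⟦X⟧ := mk fun n => coeff (5 * n + r) F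

theorem coeff_X_pow_mul_expandFive {i r : ℕ} (hi : i < 5) (hr : r < 5) (k : ℕ) (G : ℤ⟦X⟧) :
    coeff (5 * k + r) (X ^ i * expandFive G) = if i = r then coeff k G else 0 := by
  rw [coeff_X_pow_mul']
  split_ifs with h1 h2 h2
  · rw [h2, Nat.add_sub_cancel, coeff_expand_mul]
  · exact coeff_expand_of_not_dvd _ _ _ (by omega)
  · omega
  · rfl

theorem sect_sum {r : ℕ} (hr : r < 5) (A : Fin 5 → ℤ⟦X⟧) :
    sect r (∑ i : Fin 5, X ^ (i : ℕ) * expandFive (A i)) = A ⟨r, hr⟩ := by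
  ext k
  rw [sect, coeff_mk, map_sum, Finset.sum_eq_single ⟨r, hr⟩]
  · rw [coeff_X_pow_mul_expandFive hr hr, if_pos rfl]
  · intro i _ hi
    rw [coeff_X_pow_mul_expandFive i.2 hr, if_neg fun h => hi (Fin.ext h)]
  · simp

theorem eq_sum_sect (F : ℤ⟦X⟧) :
    F = ∑ i : Fin 5, X ^ (i : ℕ) * expandFive (sect i F) := by
  ext n
  obtain ⟨k, r, hr, rfl⟩ : ∃ k r, r < 5 ∧ n = 5 * k + r := ⟨n / 5, n % 5, by omega, by omega⟩
  have h := congrArg (coeff k) (sect_sum hr fun i => sect i F)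
  rw [sect, coeff_mk] at h
  rw [h, sect, coeff_mk]

theorem sect_mul_expandFive {r : ℕ} (hr : r < 5) (F G : ℤ⟦X⟧) :
    sect r (F * expandFive G) = sect r F * G := by
  have h : F * expandFive G = ∑ i : Fin 5, X ^ (i : ℕ) * expandFive (sect i F * G) := by
    conv_lhs => rw [eq_sum_sect F]
    rw [Finset.sum_mul]
    simp only [map_mul, mul_assoc]
  rw [h, sect_sum hr]

theorem coeff_eq_zero_of_hasSum {ι : Type*} {w : ι → ℤ} {e : ι → ℕ} {S : ℤ⟦X⟧} {d : ℕ}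
    (h : HasSum (fun i => C (w i) * X ^ e i) S) (hd : ∀ i, e i = d → w i = 0) :
    coeff d S = 0 := by
  rw [WithPiTopology.hasSum_iff_hasSum_coeff] at h
  refine (h d).unique (hasSum_zero.congr_fun fun i => ?_)
  rw [coeff_C_mul, coeff_X_pow]
  split_ifs with hi
  · rw [hd i hi.symm, zero_mul]
  · rw [mul_zero]

theorem hasSum_eulerFun_one :
    HasSum (fun j : ℤ => (C (intSign j) * X ^ quadExp 1 2 j : ℤ⟦X⟧)) (eulerFun 1) := by
  have h : eulerFun 1 = thetaSeries (-1) 1 2 := by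
    rw [eulerFun, eulerProd_eq_prod (-1) 1 one_pos (p := 3) (by norm_num), Fin.prod_univ_three,
      thetaSeries, mul_comm]
    rfl
  rw [h]
  exact hasSum_thetaSeries_neg_one 1 2 (by norm_num)

theorem emod_five_cases (j : ℤ) : ∃ k, j = 5 * k ∨ j = 5 * k + 1 ∨ j = 5 * k + 2 ∨
    j = 5 * k + 3 ∨ j = 5 * k + 4 := ⟨j / 5, by omega⟩

/-- In the pentagonal series the indices j = 1 - 5k have exponent 1 + 25 e(k) and opposite sign to
k, so together they form -q f_25. -/
theorem hasSum_eulerFun_one_add :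
    HasSum (fun j : ℤ => (C (if j % 5 = 1 then 0 else intSign j) * X ^ quadExp 1 2 j : ℤ⟦X⟧))
      (eulerFun 1 + X * expandFive (eulerFun 5)) := by
  have hT := two_mul_quadExp 1 2
  push_cast at hT
  have h1 := (expand_hasSum (p := 25) (by norm_num) hasSum_eulerFun_one).mul_left X
  rw [expand_eulerFun _ one_pos, show 25 * 1 = 5 * 5 by norm_num,
    ← expand_eulerFun (by norm_num) (by norm_num)] at h1
  have hinj : Function.Injective fun k : ℤ => 1 - 5 * k := fun a b h => by
    simp only at h
    omega
  have h2 : HasSum (fun j : ℤ => (C (if j % 5 = 1 then -intSign j else 0) *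
      X ^ quadExp 1 2 j : ℤ⟦X⟧)) (X * expandFive (eulerFun 5)) := by
    rw [← hinj.hasSum_iff]
    · refine h1.congr_fun fun k => ?_
      rw [Function.comp_apply, if_pos (by omega), mul_left_comm, ← pow_succ']
      congr 2
      · simp only [intSign_eq_ite]
        split_ifs <;> omega
      · rw [← Nat.cast_inj (R := ℤ)]
        push_cast
        refine mul_left_cancel₀ (two_ne_zero' ℤ) ?_
        linear_combination hT (1 - 5 * k) - 25 * hT k
    · intro j hj
      rw [if_neg, map_zero, zero_mul]
      intro h
      exact hj ⟨(1 - j) / 5, by simp only; omega⟩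
  refine (hasSum_eulerFun_one.add h2).congr_fun fun j => ?_
  rw [← add_mul, ← map_add]
  congr 2
  split_ifs <;> ring

/-- The exponents j(3j - 1)/2 are 0, 1 or 2 mod 5, and 1 only for j ≡ 1 mod 5. -/
theorem exists_dissection_eulerFun_one :
    ∃ x z : ℤ⟦X⟧, constantCoeff x = 1 ∧
      eulerFun 1 = expandFive x - X * expandFive (eulerFun 5) - X ^ 2 * expandFive z := by
  have hT := two_mul_quadExp 1 2
  push_cast at hT
  set F := eulerFun 1 + X * expandFive (eulerFun 5) with hF
  have hz : ∀ r, r < 5 → r ≠ 0 → r ≠ 2 → sect r F = 0 := by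
    intro r hr h0 h2
    ext n
    rw [sect, coeff_mk, map_zero]
    refine coeff_eq_zero_of_hasSum hasSum_eulerFun_one_add fun j hj => ?_
    have hj' := hT j
    rw [hj] at hj'
    split_ifs with h
    · rfl
    · exfalso
      obtain ⟨k, rfl | rfl | rfl | rfl | rfl⟩ := emod_five_cases j <;> ring_nf at hj' <;> omega
  refine ⟨sect 0 F, -sect 2 F, ?_, ?_⟩
  · rw [← coeff_zero_eq_constantCoeff_apply, sect, coeff_mk, hF, map_add, mul_zero, zero_add,
      coeff_zero_eq_constantCoeff_apply, constantCoeff_eulerFun one_pos]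
    simp
  · have h := eq_sum_sect F
    rw [Fin.sum_univ_five] at h
    have e1 : sect ((1 : Fin 5) : ℕ) F = 0 := hz 1 (by norm_num) (by norm_num) (by norm_num)
    have e3 : sect ((3 : Fin 5) : ℕ) F = 0 := hz 3 (by norm_num) (by norm_num) (by norm_num)
    have e4 : sect ((4 : Fin 5) : ℕ) F = 0 := hz 4 (by norm_num) (by norm_num) (by norm_num)
    rw [e1, e3, e4] at h
    simp only [map_zero, mul_zero, add_zero, Fin.val_zero, pow_zero, one_mul,
      show ((2 : Fin 5) : ℕ) = 2 from rfl] at h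
    rw [map_neg]
    linear_combination h - hF

/-- No triangular number is 2 mod 5. -/
theorem sect_two_eulerFun_one_cube : sect 2 (eulerFun 1 ^ 3) = 0 := by
  have hT := two_mul_quadExp 1 0
  push_cast at hT
  ext n
  rw [sect, coeff_mk, map_zero]
  refine coeff_eq_zero_of_hasSum (hasSum_eulerProd_cube (quadExp 1 0) fun j => by
    rw [hT]; ring) fun j hj => ?_
  exfalso
  have hj' := hT j
  rw [hj] at hj'
  obtain ⟨k, rfl | rfl | rfl | rfl | rfl⟩ := emod_five_cases j <;> ring_nf at hj' <;> omega

theorem expandFive_X : expandFive (X : ℤ⟦X⟧) = X ^ 5 := expand_X _ _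

theorem expandFive_eulerFun_one : expandFive (eulerFun 1) = eulerFun 5 :=
  expand_eulerFun _ one_pos

theorem chiFive_mul_five (d : ℕ) : chiFive (5 * d) = 0 := by
  simp [chiFive]

/-- Since χ vanishes on multiples of 5, only the divisors of n contribute among those of 5n. -/
theorem sect_zero_eisenstein : sect 0 eisenstein = eisenstein := by
  ext n
  rw [sect, coeff_mk, add_zero]
  have h5 : (5 : ℤ⟦X⟧) = C 5 := (map_ofNat C 5).symm
  simp only [eisenstein, map_sub, h5, coeff_C_mul, coeff_mk, coeff_one]
  rcases eq_or_ne n 0 with rfl | hn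
  · simp
  congr 1
  · simp [hn]
  · congr 1
    symm
    refine Finset.sum_subset (Nat.divisors_subset_of_dvd (by omega) (dvd_mul_left _ _)) ?_
    intro d hd hd'
    have h1 : 5 ∣ d := by
      by_contra h
      have hc : Nat.Coprime d 5 := ((Nat.Prime.coprime_iff_not_dvd Nat.prime_five).mpr h).symm
      exact hd' (Nat.mem_divisors.mpr
        ⟨hc.dvd_of_dvd_mul_left (Nat.dvd_of_mem_divisors hd), hn⟩)
    obtain ⟨k, rfl⟩ := h1
    rw [chiFive_mul_five]
    simp

/-- The Eisenstein series `q f_5 ^ 5 / f_1`. -/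
noncomputable def eisensteinDual : ℤ⟦X⟧ := X * eulerFun 5 ^ 5 * invOfUnit (eulerFun 1) 1

theorem eisensteinDual_mul_eulerFun : eisensteinDual * eulerFun 1 = X * eulerFun 5 ^ 5 := by
  rw [eisensteinDual, mul_assoc, invOfUnit_mul _ _ (by simpa using constantCoeff_eulerFun one_pos),
    mul_one]

/-- The cofactor of `a - q b - q ^ 2 c` in its norm `a ^ 5 - 11 q ^ 5 b ^ 5 - q ^ 10 c ^ 5`, where
`a c = b ^ 2`. -/
def normCofactor {R : Type*} [CommRing R] (q a b c : R) : R :=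
  a ^ 4 + q * a ^ 3 * b + 2 * q ^ 2 * a ^ 2 * b ^ 2 + 3 * q ^ 3 * a * b ^ 3 + 5 * q ^ 4 * b ^ 4 -
    3 * q ^ 5 * b ^ 3 * c + 2 * q ^ 6 * b ^ 2 * c ^ 2 - q ^ 7 * b * c ^ 3 + q ^ 8 * c ^ 4

/-- The right side is the product of a - ζqb - ζ²q²c over the fifth roots of unity ζ. -/
theorem mul_normCofactor {R : Type*} [CommRing R] {q a b c : R} (h : a * c = b ^ 2) :
    (a - q * b - q ^ 2 * c) * normCofactor q a b c =
      a ^ 5 - 11 * q ^ 5 * b ^ 5 - q ^ 10 * c ^ 5 := by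
  rw [normCofactor]
  linear_combination (-a ^ 3 * q ^ 2 - a ^ 2 * b * q ^ 3 - 2 * a * b ^ 2 * q ^ 4 -
    6 * b ^ 3 * q ^ 5 + 2 * b ^ 2 * c * q ^ 6 - b * c ^ 2 * q ^ 7 + c ^ 3 * q ^ 8) * h

theorem mul_eq_mul_normCofactor {R : Type*} [CommRing R] [IsDomain R] {q a b c y f D : R}
    (hf : f = a - q * b - q ^ 2 * c) (h : a * c = b ^ 2)
    (hN : (a ^ 5 - 11 * q ^ 5 * b ^ 5 - q ^ 10 * c ^ 5) * b = y ^ 6)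
    (hD : D * f = q * y ^ 5) (hf0 : f ≠ 0) :
    D * y = q * b * normCofactor q a b c := by
  have h1 := mul_normCofactor (q := q) h
  rw [← hf] at h1
  refine mul_left_cancel₀ hf0 ?_
  linear_combination y * hD - q * hN - q * b * h1

/-- Cubing the dissection, section 2 of f_1^3 is 3x(f_5² - xz), and it is zero. -/
theorem dissection_mul {x z : ℤ⟦X⟧} (hx : constantCoeff x = 1)
    (hf : eulerFun 1 = expandFive x - X * expandFive (eulerFun 5) - X ^ 2 * expandFive z) :
    x * z = eulerFun 5 ^ 2 := by
  have h2 := sect_two_eulerFun_one_cube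
  generalize eulerFun 1 = f at hf h2
  generalize eulerFun 5 = y at hf
  have h : f ^ 3 = ∑ i : Fin 5, X ^ (i : ℕ) * expandFive (![x ^ 3 - 3 * X * y * z ^ 2,
      -3 * x ^ 2 * y - X * z ^ 3, 3 * x * (y ^ 2 - x * z), 6 * x * y * z - y ^ 3,
      3 * z * (x * z - y ^ 2)] i) := by
    rw [Fin.sum_univ_five, hf]
    simp only [Matrix.cons_val, Fin.val_zero, Fin.val_one, Fin.val_two, map_sub, map_mul,
      map_pow, map_ofNat, map_neg, expandFive_X, show ((3 : Fin 5) : ℕ) = 3 from rfl,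
      show ((4 : Fin 5) : ℕ) = 4 from rfl]
    ring
  rw [h, sect_sum (by norm_num)] at h2
  have h3 : 3 * x * (y ^ 2 - x * z) = 0 := h2
  have h4 : (3 * x : ℤ⟦X⟧) ≠ 0 := fun h => by
    have := congrArg constantCoeff h
    rw [map_mul, hx, map_ofNat] at this
    norm_num at this
  have := (mul_eq_zero.mp h3).resolve_left h4
  linear_combination -this

/-- Section 0 of f_1^5 = E f_5 is E f_1, because E is its own section 0; expanding the fifth power
by the dissection gives the norm. -/
theorem dissection_norm {x z : ℤ⟦X⟧}
    (hf : eulerFun 1 = expandFive x - X * expandFive (eulerFun 5) - X ^ 2 * expandFive z)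
    (hxz : x * z = eulerFun 5 ^ 2) :
    (x ^ 5 - 11 * X * eulerFun 5 ^ 5 - X ^ 2 * z ^ 5) * eulerFun 5 = eulerFun 1 ^ 6 := by
  have hE := eisenstein_mul_eulerFun
  have h2 : sect 0 (eulerFun 1 ^ 5) = eisenstein * eulerFun 1 := by
    rw [← hE, ← expandFive_eulerFun_one, sect_mul_expandFive (by norm_num), sect_zero_eisenstein]
  generalize eulerFun 1 = f at *
  generalize eulerFun 5 = y at *
  generalize eisenstein = E at *
  have h : f ^ 5 = ∑ i : Fin 5, X ^ (i : ℕ) * expandFive (![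
      x ^ 5 - 30 * x ^ 2 * y * z ^ 2 * X + 20 * x * y ^ 3 * z * X - y ^ 5 * X - z ^ 5 * X ^ 2,
      -5 * x ^ 4 * y - 10 * x ^ 2 * z ^ 3 * X + 30 * x * y ^ 2 * z ^ 2 * X -
        5 * y ^ 4 * z * X,
      -5 * x ^ 4 * z + 10 * x ^ 3 * y ^ 2 + 20 * x * y * z ^ 3 * X - 10 * y ^ 3 * z ^ 2 * X,
      20 * x ^ 3 * y * z - 10 * x ^ 2 * y ^ 3 + 5 * x * z ^ 4 * X - 10 * y ^ 2 * z ^ 3 * X,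
      10 * x ^ 3 * z ^ 2 - 30 * x ^ 2 * y ^ 2 * z + 5 * x * y ^ 4 - 5 * y * z ^ 4 * X] i) := by
    rw [Fin.sum_univ_five, hf]
    simp only [Matrix.cons_val, Fin.val_zero, Fin.val_one, Fin.val_two, map_sub, map_add, map_mul,
      map_pow, map_ofNat, map_neg, expandFive_X, show ((3 : Fin 5) : ℕ) = 3 from rfl,
      show ((4 : Fin 5) : ℕ) = 4 from rfl]
    ring
  rw [h, sect_sum (by norm_num)] at h2
  have h3 : x ^ 5 - 30 * x ^ 2 * y * z ^ 2 * X + 20 * x * y ^ 3 * z * X -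
    y ^ 5 * X - z ^ 5 * X ^ 2 = E * f := h2
  linear_combination y * h3 + f * hE + y * (30 * x * y * z * X + 10 * y ^ 3 * X) * hxz

/-- The norm identity, after q ↦ q^5, rationalises 1/f_1 and so makes the 5-dissection of D f_5
explicit. -/
theorem eisensteinDual_mul_eulerFun_five {x z : ℤ⟦X⟧}
    (hf : eulerFun 1 = expandFive x - X * expandFive (eulerFun 5) - X ^ 2 * expandFive z)
    (hxz : x * z = eulerFun 5 ^ 2) :
    eisensteinDual * eulerFun 5 = X * expandFive (eulerFun 5) *
      normCofactor X (expandFive x) (expandFive (eulerFun 5)) (expandFive z) := by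
  refine mul_eq_mul_normCofactor hf ?_ ?_ eisensteinDual_mul_eulerFun (eulerFun_ne_zero one_pos)
  · rw [← map_mul, hxz, map_pow]
  · have := congrArg expandFive (dissection_norm hf hxz)
    rw [map_pow, expandFive_eulerFun_one] at this
    rw [← this]
    simp only [map_sub, map_mul, map_pow, map_ofNat, expandFive_X]
    ring

theorem sect_eq_zero_of_mul {r : ℕ} (hr : r < 5) {F : ℤ⟦X⟧} {A : Fin 5 → ℤ⟦X⟧}
    (h : F * eulerFun 5 = ∑ i : Fin 5, X ^ (i : ℕ) * expandFive (A i)) (hA : A ⟨r, hr⟩ = 0) :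
    sect r F = 0 := by
  have h1 := congrArg (sect r) h
  rw [← expandFive_eulerFun_one, sect_mul_expandFive hr, sect_sum hr, hA] at h1
  exact (mul_eq_zero.mp h1).resolve_right (eulerFun_ne_zero one_pos)

/-- Multiplying by f_5, a series in q^5, respects sections and makes both series polynomials in the
dissection; the sections in question are multiples of xz - f_5². -/
theorem sect_eisenstein_add : sect 1 (eisenstein + 5 * eisensteinDual) = 0 ∧
    sect 4 (eisenstein + 5 * eisensteinDual) = 0 := by
  obtain ⟨x, z, hx, hf⟩ := exists_dissection_eulerFun_one
  have hxz := dissection_mul hx hf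
  have h : (eisenstein + 5 * eisensteinDual) * eulerFun 5 =
      ∑ i : Fin 5, X ^ (i : ℕ) * expandFive (![
        x ^ 5 - 30 * x ^ 2 * eulerFun 5 * z ^ 2 * X + 20 * x * eulerFun 5 ^ 3 * z * X +
          24 * eulerFun 5 ^ 5 * X - z ^ 5 * X ^ 2,
        -10 * x ^ 2 * z ^ 3 * X + 30 * x * eulerFun 5 ^ 2 * z ^ 2 * X -
          20 * eulerFun 5 ^ 4 * z * X,
        -5 * x ^ 4 * z + 15 * x ^ 3 * eulerFun 5 ^ 2 + 20 * x * eulerFun 5 * z ^ 3 * X,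
        20 * x ^ 3 * eulerFun 5 * z + 5 * x * z ^ 4 * X - 15 * eulerFun 5 ^ 2 * z ^ 3 * X,
        10 * x ^ 3 * z ^ 2 - 30 * x ^ 2 * eulerFun 5 ^ 2 * z + 20 * x * eulerFun 5 ^ 4] i) := by
    rw [add_mul, eisenstein_mul_eulerFun, mul_assoc, eisensteinDual_mul_eulerFun_five hf hxz, hf,
      Fin.sum_univ_five, normCofactor]
    simp only [Matrix.cons_val, Fin.val_zero, Fin.val_one, Fin.val_two, map_sub, map_add, map_mul,
      map_pow, map_ofNat, map_neg, expandFive_X, show ((3 : Fin 5) : ℕ) = 3 from rfl,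
      show ((4 : Fin 5) : ℕ) = 4 from rfl]
    ring
  constructor
  · refine sect_eq_zero_of_mul (by norm_num) h ?_
    change -10 * x ^ 2 * z ^ 3 * X + 30 * x * eulerFun 5 ^ 2 * z ^ 2 * X -
          20 * eulerFun 5 ^ 4 * z * X = 0
    linear_combination (-10 * x * z ^ 2 * X + 20 * eulerFun 5 ^ 2 * z * X) * hxz
  · refine sect_eq_zero_of_mul (by norm_num) h ?_
    change 10 * x ^ 3 * z ^ 2 - 30 * x ^ 2 * eulerFun 5 ^ 2 * z + 20 * x * eulerFun 5 ^ 4 = 0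
    linear_combination (10 * x ^ 2 * z - 20 * x * eulerFun 5 ^ 2) * hxz

theorem sect_eisenstein_sub : sect 2 (eisenstein - 5 * eisensteinDual) = 0 ∧
    sect 3 (eisenstein - 5 * eisensteinDual) = 0 := by
  obtain ⟨x, z, hx, hf⟩ := exists_dissection_eulerFun_one
  have hxz := dissection_mul hx hf
  have h : (eisenstein - 5 * eisensteinDual) * eulerFun 5 =
      ∑ i : Fin 5, X ^ (i : ℕ) * expandFive (![
        x ^ 5 - 30 * x ^ 2 * eulerFun 5 * z ^ 2 * X + 20 * x * eulerFun 5 ^ 3 * z * X -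
          26 * eulerFun 5 ^ 5 * X - z ^ 5 * X ^ 2,
        -10 * x ^ 4 * eulerFun 5 - 10 * x ^ 2 * z ^ 3 * X + 30 * x * eulerFun 5 ^ 2 * z ^ 2 * X +
          10 * eulerFun 5 ^ 4 * z * X,
        -5 * x ^ 4 * z + 5 * x ^ 3 * eulerFun 5 ^ 2 + 20 * x * eulerFun 5 * z ^ 3 * X -
          20 * eulerFun 5 ^ 3 * z ^ 2 * X,
        20 * x ^ 3 * eulerFun 5 * z - 20 * x ^ 2 * eulerFun 5 ^ 3 + 5 * x * z ^ 4 * X -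
          5 * eulerFun 5 ^ 2 * z ^ 3 * X,
        10 * x ^ 3 * z ^ 2 - 30 * x ^ 2 * eulerFun 5 ^ 2 * z - 10 * x * eulerFun 5 ^ 4 -
          10 * eulerFun 5 * z ^ 4 * X] i) := by
    rw [sub_mul, eisenstein_mul_eulerFun, mul_assoc, eisensteinDual_mul_eulerFun_five hf hxz, hf,
      Fin.sum_univ_five, normCofactor]
    simp only [Matrix.cons_val, Fin.val_zero, Fin.val_one, Fin.val_two, map_sub, map_add, map_mul,
      map_pow, map_ofNat, map_neg, expandFive_X, show ((3 : Fin 5) : ℕ) = 3 from rfl,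
      show ((4 : Fin 5) : ℕ) = 4 from rfl]
    ring
  constructor
  · refine sect_eq_zero_of_mul (by norm_num) h ?_
    change -5 * x ^ 4 * z + 5 * x ^ 3 * eulerFun 5 ^ 2 + 20 * x * eulerFun 5 * z ^ 3 * X -
          20 * eulerFun 5 ^ 3 * z ^ 2 * X = 0
    linear_combination (-5 * x ^ 3 + 20 * eulerFun 5 * z ^ 2 * X) * hxz
  · refine sect_eq_zero_of_mul (by norm_num) h ?_
    change 20 * x ^ 3 * eulerFun 5 * z - 20 * x ^ 2 * eulerFun 5 ^ 3 + 5 * x * z ^ 4 * X -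
          5 * eulerFun 5 ^ 2 * z ^ 3 * X = 0
    linear_combination (20 * x ^ 2 * eulerFun 5 + 5 * z ^ 3 * X) * hxz

/-! ### Relations of level 10. -/

theorem eulerFun_relation_psi :
    eulerFun 2 ^ 4 * eulerFun 10 * eulerFun 5 ^ 2 =
      eulerFun 1 * eulerFun 2 * eulerFun 5 ^ 5 + X * eulerFun 1 ^ 2 * eulerFun 10 ^ 5 := by
  have h1 := psiPos_mul_eulerFun
  have h5 := congrArg expandFive h1
  rw [map_mul, map_pow, expandFive_eulerFun_one, expand_eulerFun _ two_pos] at h5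
  have hT : thetaSeries 1 1 4 * thetaSeries 1 2 3 * (eulerFun 1 * eulerFun 10) =
      eulerFun 2 * eulerFun 5 ^ 3 := by
    have h := prod_eulerProd_one_mul
    have h0 : eulerFun 5 = eulerProd (-1) 5 5 := rfl
    simp only [thetaSeries]
    norm_num only
    rw [← h0]
    linear_combination eulerFun 5 ^ 2 * h
  have h := psiPos_sq
  norm_num only at h5
  linear_combination (eulerFun 1 ^ 2 * eulerFun 10 * eulerFun 5 ^ 2) * h -
    eulerFun 10 * eulerFun 5 ^ 2 * (psiPos * eulerFun 1 + eulerFun 2 ^ 2) * h1 +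
    X * eulerFun 1 ^ 2 * eulerFun 10 * (expandFive psiPos * eulerFun 5 + eulerFun 10 ^ 2) * h5 +
    eulerFun 1 * eulerFun 5 ^ 2 * hT

theorem eulerFun_relation_phi :
    eulerFun 1 ^ 4 * eulerFun 10 ^ 2 * eulerFun 5 =
      eulerFun 5 ^ 5 * eulerFun 2 ^ 2 - 4 * X * eulerFun 10 ^ 5 * eulerFun 1 * eulerFun 2 := by
  have h1 := phiNeg_mul_eulerFun
  have h5 := congrArg expandFive h1
  rw [map_mul, map_pow, expandFive_eulerFun_one, expand_eulerFun _ two_pos] at h5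
  have hT : thetaSeries (-1) 1 9 * thetaSeries (-1) 7 3 * (eulerFun 2 * eulerFun 5) =
      eulerFun 1 * eulerFun 10 ^ 3 := by
    have h := prod_eulerProd_ten_mul
    have h0 : eulerFun 10 = eulerProd (-1) 10 10 := rfl
    simp only [thetaSeries]
    norm_num only
    rw [← h0]
    linear_combination eulerFun 10 ^ 2 * h
  have h := phiNeg_sq
  norm_num only at h5
  linear_combination (eulerFun 2 ^ 2 * eulerFun 10 ^ 2 * eulerFun 5) * h -
    eulerFun 10 ^ 2 * eulerFun 5 * (phiNeg * eulerFun 2 + eulerFun 1 ^ 2) * h1 +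
    eulerFun 2 ^ 2 * eulerFun 5 * (expandFive phiNeg * eulerFun 10 + eulerFun 5 ^ 2) * h5 -
    4 * X * eulerFun 2 * eulerFun 10 ^ 2 * hT

/-- The relations of level `10` between the Eisenstein series `E`, `D`, their images `E'`, `D'`
under `q ↦ q ^ 2` and the eta quotients `A = D ^ 2 / D'`, `B = D' ^ 2 / D`. -/
theorem level_ten_relations {R : Type*} [CommRing R] [IsDomain R]
    {q f₁ f₂ f₅ f₁₀ E D E' D' A B : R} (hq : q ≠ 0) (h₁ : f₁ ≠ 0) (h₂ : f₂ ≠ 0) (h₅ : f₅ ≠ 0)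
    (h₁₀ : f₁₀ ≠ 0)
    (hψ : f₂ ^ 4 * f₁₀ * f₅ ^ 2 = f₁ * f₂ * f₅ ^ 5 + q * f₁ ^ 2 * f₁₀ ^ 5)
    (hφ : f₁ ^ 4 * f₁₀ ^ 2 * f₅ = f₅ ^ 5 * f₂ ^ 2 - 4 * q * f₁₀ ^ 5 * f₁ * f₂)
    (hE : E * f₅ = f₁ ^ 5) (hD : D * f₁ = q * f₅ ^ 5)
    (hE' : E' * f₁₀ = f₂ ^ 5) (hD' : D' * f₂ = q ^ 2 * f₁₀ ^ 5)
    (hA : A * (f₁ ^ 2 * f₁₀ ^ 5) = f₅ ^ 10 * f₂)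
    (hB : B * (f₂ ^ 2 * f₅ ^ 5) = q ^ 3 * (f₁₀ ^ 10 * f₁)) :
    5 * A = E + 4 * E' + 15 * D + 20 * D' ∧ 20 * B = E - E' + 5 * D - 15 * D' := by
  have hD0 : D ≠ 0 := fun h => by
    rw [h, zero_mul] at hD
    exact mul_ne_zero hq (pow_ne_zero 5 h₅) hD.symm
  have hD0' : D' ≠ 0 := fun h => by
    rw [h, zero_mul] at hD'
    exact mul_ne_zero (pow_ne_zero 2 hq) (pow_ne_zero 5 h₁₀) hD'.symm
  have hAD : A * D' = D ^ 2 := by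
    refine mul_right_cancel₀ (mul_ne_zero (mul_ne_zero (pow_ne_zero 2 h₁) (pow_ne_zero 5 h₁₀)) h₂) ?_
    linear_combination D' * f₂ * hA + f₅ ^ 10 * f₂ * hD' -
      f₁₀ ^ 5 * f₂ * (D * f₁ + q * f₅ ^ 5) * hD
  have hBD : B * D = D' ^ 2 := by
    refine mul_right_cancel₀ (mul_ne_zero (mul_ne_zero (pow_ne_zero 2 h₂) (pow_ne_zero 5 h₅)) h₁) ?_
    linear_combination D * f₁ * hB + q ^ 3 * f₁₀ ^ 10 * f₁ * hD -
      f₅ ^ 5 * f₁ * (D' * f₂ + q ^ 2 * f₁₀ ^ 5) * hD'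
  -- D + D' and D - 4D' are themselves eta quotients; this is the content of the ψ and φ relations.
  have hS : (D + D') * f₁ ^ 2 = q * f₂ ^ 3 * f₁₀ * f₅ ^ 2 := by
    refine mul_right_cancel₀ h₂ ?_
    linear_combination f₁ * f₂ * hD + f₁ ^ 2 * hD' - q * hψ
  have hT : (D - 4 * D') * f₂ ^ 2 = q * f₁ ^ 3 * f₅ * f₁₀ ^ 2 := by
    refine mul_right_cancel₀ h₁ ?_
    linear_combination f₂ ^ 2 * hD - 4 * f₁ * f₂ * hD' - q * hφ
  have hTT : (D - 4 * D') ^ 2 * f₂ ^ 4 = q ^ 2 * f₁ ^ 6 * f₅ ^ 2 * f₁₀ ^ 4 := by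
    linear_combination ((D - 4 * D') * f₂ ^ 2 + q * f₁ ^ 3 * f₅ * f₁₀ ^ 2) * hT
  have hSS : (D + D') ^ 2 * f₁ ^ 4 = q ^ 2 * f₂ ^ 6 * f₁₀ ^ 2 * f₅ ^ 4 := by
    linear_combination ((D + D') * f₁ ^ 2 + q * f₂ ^ 3 * f₁₀ * f₅ ^ 2) * hS
  have hDD : D * D' * (f₁ * f₂) = q ^ 3 * f₅ ^ 5 * f₁₀ ^ 5 := by
    linear_combination D' * f₂ * hD + q * f₅ ^ 5 * hD'
  have hED : E * (D * D') = (D - 4 * D') ^ 2 * (D + D') := by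
    -- Both sides are now eta quotients. With its companion for E' this makes E and E' rational in D
    -- and D', so the claims become identities of binary cubic forms.
    refine mul_right_cancel₀ (mul_ne_zero h₅ (mul_ne_zero (pow_ne_zero 2 h₁) (pow_ne_zero 4 h₂))) ?_
    linear_combination D * D' * f₁ ^ 2 * f₂ ^ 4 * hE + f₁ ^ 6 * f₂ ^ 3 * hDD -
      f₅ * (D + D') * f₁ ^ 2 * hTT - f₅ * q ^ 2 * f₁ ^ 6 * f₅ ^ 2 * f₁₀ ^ 4 * hS
  have hED' : E' * (D * D') = (D + D') ^ 2 * (D - 4 * D') := by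
    refine mul_right_cancel₀
      (mul_ne_zero h₁₀ (mul_ne_zero (pow_ne_zero 4 h₁) (pow_ne_zero 2 h₂))) ?_
    linear_combination D * D' * f₁ ^ 4 * f₂ ^ 2 * hE' + f₁ ^ 3 * f₂ ^ 6 * hDD -
      f₁₀ * (D - 4 * D') * f₂ ^ 2 * hSS - f₁₀ * q ^ 2 * f₂ ^ 6 * f₁₀ ^ 2 * f₅ ^ 4 * hT
  constructor
  · refine mul_right_cancel₀ (mul_ne_zero hD0 hD0') ?_
    linear_combination 5 * D * hAD - hED - 4 * hED'
  · refine mul_right_cancel₀ (mul_ne_zero hD0 hD0') ?_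
    linear_combination 20 * D' * hBD - hED + hED'

theorem rescale_expandFive (F : ℤ⟦X⟧) :
    rescale (-1) (expandFive F) = expandFive (rescale (-1) F) := by
  ext n
  rw [coeff_rescale, coeff_expand, coeff_expand]
  split_ifs with h
  · obtain ⟨k, rfl⟩ := h
    rw [Nat.mul_div_cancel_left _ (by norm_num), coeff_rescale, pow_mul]
    norm_num
  · rw [mul_zero]

theorem five_mul_fiveCoreQuotient_phiNeg :
    5 * fiveCoreQuotient phiNeg =
        eisenstein + 4 * expand 2 two_ne_zero eisenstein + 15 * eisensteinDual +
          20 * expand 2 two_ne_zero eisensteinDual ∧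
      20 * (X ^ 3 * rescale (-1) (fiveCoreQuotient psiNeg)) =
        eisenstein - expand 2 two_ne_zero eisenstein + 5 * eisensteinDual -
          15 * expand 2 two_ne_zero eisensteinDual := by
  have hE' := congrArg (expand 2 two_ne_zero) eisenstein_mul_eulerFun
  have hD' := congrArg (expand 2 two_ne_zero) eisensteinDual_mul_eulerFun
  simp only [map_mul, map_pow, expand_X, expand_eulerFun _ (show 0 < 5 by norm_num),
    expand_eulerFun _ one_pos] at hE' hD'
  norm_num only at hE' hD'
  have hφ := phiNeg_mul_eulerFun
  have hψ := psiPos_mul_eulerFun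
  have hφ5 := congrArg expandFive hφ
  have hψ5 := congrArg expandFive hψ
  rw [map_mul, map_pow, expandFive_eulerFun_one, expand_eulerFun _ two_pos] at hφ5 hψ5
  norm_num only at hφ5 hψ5
  have hA : fiveCoreQuotient phiNeg * phiNeg = expandFive phiNeg ^ 5 :=
    fiveCoreQuotient_mul _ constantCoeff_phiNeg
  have hB : rescale (-1) (fiveCoreQuotient psiNeg) * psiPos = expandFive psiPos ^ 5 := by
    have := congrArg (rescale (-1 : ℤ)) (fiveCoreQuotient_mul _ constantCoeff_psiNeg)
    rw [map_mul, map_pow, rescale_expandFive] at this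
    exact this
  refine level_ten_relations X_ne_zero (eulerFun_ne_zero one_pos) (eulerFun_ne_zero two_pos)
    (eulerFun_ne_zero (by norm_num)) (eulerFun_ne_zero (by norm_num)) eulerFun_relation_psi
    eulerFun_relation_phi eisenstein_mul_eulerFun eisensteinDual_mul_eulerFun hE' ?_ ?_ ?_
  · exact hD'
  · have hp : expandFive phiNeg ^ 5 * eulerFun 10 ^ 5 = eulerFun 5 ^ 10 := by
      rw [← mul_pow, hφ5, ← pow_mul]
    rw [← hφ]
    linear_combination eulerFun 2 * eulerFun 10 ^ 5 * hA + eulerFun 2 * hp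
  · have hp : expandFive psiPos ^ 5 * eulerFun 5 ^ 5 = eulerFun 10 ^ 10 := by
      rw [← mul_pow, hψ5, ← pow_mul]
    rw [← hψ]
    linear_combination X ^ 3 * eulerFun 1 * eulerFun 5 ^ 5 * hB + X ^ 3 * eulerFun 1 * hp

/-! ### Comparison of coefficients. -/

theorem chiFive_two_mul (d : ℕ) : chiFive (2 * d) = -chiFive d := by
  unfold chiFive
  split_ifs <;> omega

theorem sum_divisors_two_mul_chiFive {m : ℕ} (hm : m % 2 = 1) :
    ∑ d ∈ (2 * m).divisors, chiFive d * d = -∑ d ∈ m.divisors, chiFive d * d := by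
  have hdiv : (2 * m).divisors = m.divisors ∪ m.divisors.image (2 * ·) := by
    ext d
    simp only [Finset.mem_union, Finset.mem_image, Nat.mem_divisors]
    constructor
    · rintro ⟨hd, -⟩
      obtain ⟨a, b, ha, hb, rfl⟩ := (Nat.dvd_mul).mp hd
      rcases (Nat.dvd_prime Nat.prime_two).mp ha with rfl | rfl
      · exact Or.inl ⟨by rwa [one_mul], by omega⟩
      · exact Or.inr ⟨b, ⟨hb, by omega⟩, rfl⟩
    · rintro (⟨hd, _⟩ | ⟨b, ⟨hb, _⟩, rfl⟩)
      · exact ⟨hd.mul_left 2, by omega⟩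
      · exact ⟨Nat.mul_dvd_mul_left 2 hb, by omega⟩
  have hdisj : Disjoint m.divisors (m.divisors.image (2 * ·)) := by
    rw [Finset.disjoint_left]
    intro d hd hd'
    obtain ⟨b, -, rfl⟩ := Finset.mem_image.mp hd'
    have h2 : 2 ∣ m := (Dvd.intro b rfl).trans (Nat.dvd_of_mem_divisors hd)
    omega
  rw [hdiv, Finset.sum_union hdisj, Finset.sum_image fun a _ b _ h => by simpa using h,
    ← Finset.sum_add_distrib, ← Finset.sum_neg_distrib]
  refine Finset.sum_congr rfl fun d _ => ?_
  rw [chiFive_two_mul]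
  push_cast
  ring

theorem coeff_eisenstein {n : ℕ} (hn : n ≠ 0) :
    coeff n eisenstein = -5 * ∑ d ∈ n.divisors, chiFive d * d := by
  have h5 : (5 : ℤ⟦X⟧) = C 5 := (map_ofNat C 5).symm
  rw [eisenstein, map_sub, h5, coeff_C_mul, coeff_mk, coeff_one, if_neg hn]
  ring

/-- The conditions on m mean χ(m) = -1 and χ(2m) = 1, so E_m = 5D_m and E_{2m} = -5D_{2m}; k = m - 3
is even, so the rescaling by -1 is harmless. -/
theorem aBar5_two_mul {m k : ℕ} (hk : m = k + 3) (hm : m % 2 = 1) (h5 : m % 5 = 2 ∨ m % 5 = 3) :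
    aBar5 (2 * m) = 20 * bBar5 k := by
  obtain ⟨hA, hB⟩ := five_mul_fiveCoreQuotient_phiNeg
  have hofNat : ∀ (c : ℕ) [c.AtLeastTwo], (ofNat(c) : ℤ⟦X⟧) = C (ofNat(c) : ℤ) :=
    fun c _ => (map_ofNat C c).symm
  have hA2 := congrArg (coeff (2 * m)) hA
  have hBm := congrArg (coeff m) hB
  have hodd : ¬ 2 ∣ m := by omega
  simp only [hofNat, map_add, map_sub, coeff_C_mul, coeff_expand_mul,
    coeff_expand_of_not_dvd _ _ _ hodd] at hA2 hBm
  have hb : coeff m (X ^ 3 * rescale (-1) (fiveCoreQuotient psiNeg)) = bBar5 k := by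
    rw [hk, coeff_X_pow_mul, coeff_rescale, bBar5, Even.neg_one_pow (Nat.even_iff.mpr (by omega)),
      one_mul]
  have hE2 : coeff (2 * m) eisenstein = -coeff m eisenstein := by
    rw [coeff_eisenstein (by omega), coeff_eisenstein (by omega), sum_divisors_two_mul_chiFive hm]
    ring
  have hsect : ∀ (F : ℤ⟦X⟧) (n : ℕ), sect (n % 5) F = 0 → coeff n F = 0 := fun F n h => by
    have := congrArg (coeff (n / 5)) h
    rwa [sect, coeff_mk, Nat.div_add_mod, map_zero] at this
  have h1 : coeff (2 * m) (eisenstein + 5 * eisensteinDual) = 0 := by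
    refine hsect _ _ ?_
    rcases h5 with h | h
    · rw [show 2 * m % 5 = 4 by omega]; exact sect_eisenstein_add.2
    · rw [show 2 * m % 5 = 1 by omega]; exact sect_eisenstein_add.1
  have h2 : coeff m (eisenstein - 5 * eisensteinDual) = 0 := by
    refine hsect _ _ ?_
    rcases h5 with h | h
    · rw [h]; exact sect_eisenstein_sub.1
    · rw [h]; exact sect_eisenstein_sub.2
  simp only [hofNat, map_add, map_sub, coeff_C_mul] at h1 h2
  rw [hb] at hBm
  have hA3 : aBar5 (2 * m) = coeff (2 * m) (fiveCoreQuotient phiNeg) := rfl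
  rw [hA3]
  linarith

theorem corollary7 (n : ℕ) :
    aBar5 (20 * n + 6) = 20 * bBar5 (10 * n) ∧
    aBar5 (20 * n + 14) = 20 * bBar5 (10 * n + 4) ∧
    aBar5 (20 * n + 6) ≡ 0 [ZMOD 5] := by
  have h1 : aBar5 (20 * n + 6) = 20 * bBar5 (10 * n) := by
    rw [show 20 * n + 6 = 2 * (10 * n + 3) by ring]
    exact aBar5_two_mul rfl (by omega) (by omega)
  refine ⟨h1, ?_, ?_⟩
  · rw [show 20 * n + 14 = 2 * (10 * n + 7) by ring]
    exact aBar5_two_mul rfl (by omega) (by omega)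
  · rw [h1, Int.modEq_zero_iff_dvd]
    exact ⟨4 * bBar5 (10 * n), by ring⟩
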